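/- **Setting.** Fix $K\ge 1$ and a symmetric matrix $\Lambda$ of size $K\times K$ with all entries in $(0,1)$. For each $n$ let $b=b_n:[n]\to[K]$ be a block assignment with block sizes $n_k=|b^{-1}(k)|$, and let $G$ be a graph on $[n]$ (adjacency matrix $A$) whose edges are independent, $\{u,v\}$ being present with probability $\Lambda_{b(u),b(v)}$. Independently of $G$, a set $S$ of $m=m(n)$ seeds is chosen uniformly at random among the $m$-subsets of $[n]$, and the blocks of the seeds are observed. Put $S_k=S\cap b^{-1}(k)$, $m_k=|S_k|$, $U=[n]\setminus S$, $\mathfrak u=|U|$, $U_k=U\cap b^{-1}(k)$, $\mathfrak u_k=|U_k|$. Block $1$ is the block of interest. A nomination list is a bijection $\mathcal L:U\to\{1,\dots,\mathfrak u\}$, and $$\operatorname{AP}(\mathcal L)=\frac1{\mathfrak u_1}\sum_{i=1}^{\mathfrak u_1}\frac{|\{j\le i:\mathcal L^{-1}(j)\in U_1\}|}{i}.$$ The canonical scheme $\mathcal L^{C}$ (which knows $\Lambda$ and the $n_k$) lists the nonseeds by decreasing conditional probability of lying in block $1$ given $G$ and the seed blocks, all assignments with block sizes $n_k$ that agree with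 $b$ on $S$ being equally likely a priori, ties being broken uniformly at random. A scheme $\mathcal L$ is consistent if $|\mathbb E\operatorname{AP}(\mathcal L^C)-\mathbb E\operatorname{AP}(\mathcal L)|\to0$ as $n\to\infty$. **The scheme with estimated parameters.** Let $\widehat\Lambda_{k\ell}$ be the number of edges between $S_k$ and $S_\ell$ divided by $m_km_\ell$ if $k\ne\ell$, and the number of edges inside $S_k$ divided by $\binom{m_k}2$ if $k=\ell$. Let $\hat n_k$ be integers with $\sum_k\hat n_k=n$ and $|\hat n_k-m_kn/m|<1$ (the estimates $m_kn/m$, rounded in any way). Choose any labelling $c:[n]\to[K]$ that agrees with $b$ on $S$ and has $|c^{-1}(k)|=\hat n_k$, and let $\widehat B_{ij}=\log\bigl(\widehat\Lambda_{c(i)c(j)}/(1-\widehat\Lambda_{c(i)c(j)})\bigr)$. Write $M^{(1,2)}$ and $M^{(2,2)}$ for the $S\times U$ and $U\times U$ submatrices of $M$. Let $P$, with permutation $\sigma$ of $U$, be any minimizer over permutation matrices of $$-\tfrac12\operatorname{tr}\bigl(A^{(2,2)}P(\widehat B^{(2,2)})^{\top}P^{\top}\bigr)-\operatorname{tr}\bigl((A^{(1,2)})^{\top}\widehat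 B^{(1,2)}P^{\top}\bigr),$$ and put $\phi=c\circ\sigma$, with $\sigma$ extended by the identity on $S$. Let $\ell(\psi)$ be the product over the pairs of vertices $\{i,j\}$ not both in $S$ of $\widehat\Lambda_{\psi(i)\psi(j)}^{A_{ij}}(1-\widehat\Lambda_{\psi(i)\psi(j)})^{1-A_{ij}}$, and let $\phi_{i\leftrightarrow j}$ be $\phi$ with the labels of $i$ and $j$ exchanged. For $i\in U$ with $\phi(i)=1$ let $\eta(i)$ be the geometric mean of $\ell(\phi_{i\leftrightarrow j})/\ell(\phi)$ over $j\in U$ with $\phi(j)\ne1$; for $i\in U$ with $\phi(i)\neq1$ let $\xi(i)$ be the geometric mean of the same ratios over $j\in U$ with $\phi(j)=1$. Then $\mathcal L^{\mathrm{ML}}$ lists first the $i\in U$ with $\phi(i)=1$ by increasing $\eta(i)$, then the other $i\in U$ by decreasing $\xi(i)$, ties being broken uniformly at random. **Theorem.** Assume that (i) $\Lambda_{kk}\ne\Lambda_{k\ell}$ whenever $k\ne\ell$; (ii) $n_k=\Theta(n)$ for each $k\in[K]$; (iii) $m_k=\omega(n^{2/3}\log n)$ for each $k\in[K]$, that is,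 for every $C$, with probability tending to $1$, $m_k\ge C\,n^{2/3}\log n$ for all $k$; (iv) $\mathbb P(\mathfrak u_1>0)\to1$. Then, for every choice of roundings, labellings and minimizers as above, $$\lim_{n\to\infty}\mathbb E\operatorname{AP}(\mathcal L^{\mathrm{ML}})=1,$$ and $\mathcal L^{\mathrm{ML}}$ is consistent. In particular $m=o(n)$ is allowed: the seeds may be a vanishing fraction of the vertices. -/

import Mathlib

open Filter Topology Finset Asymptotics

namespace VertexNomination

noncomputable section

/-! Vertices are the elements of `Fin n`, blocks those of `Fin K`, and block `0` is the block of
interest. A block assignment is a function `b : Fin n → Fin K`. -/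

/-- The number of vertices in block `k`. -/
def blockSize {n K : ℕ} (b : Fin n → Fin K) (k : Fin K) : ℕ :=
  #{v : Fin n | b v = k}

/-- The set `S_k` of seeds in block `k`. -/
def seedBlock {n K : ℕ} (b : Fin n → Fin K) (S : Finset (Fin n)) (k : Fin K) : Finset (Fin n) :=
  {v ∈ S | b v = k}

/-- The nonseed vertices. -/
abbrev NonSeed {n : ℕ} (S : Finset (Fin n)) : Type := {v : Fin n // v ∉ S}

/-- The number of nonseed vertices that lie in the block of interest. -/
def numTarget {n K : ℕ} [NeZero K] (b : Fin n → Fin K) (S : Finset (Fin n)) : ℕ :=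
  (univ.filter fun v : NonSeed S => b v = 0).card

/-! ### The stochastic block model and the random seed set -/

open scoped Classical in
/-- `Λ_{kl}^a (1 - Λ_{kl})^(1 - a)`, where `a` is the adjacency indicator of `u` and `v` and
`k`, `l` are their blocks under `b`. -/
def edgeFactor {n K : ℕ} (Λ : Matrix (Fin K) (Fin K) ℝ) (b : Fin n → Fin K)
    (G : SimpleGraph (Fin n)) (u v : Fin n) : ℝ :=
  if G.Adj u v then Λ (b u) (b v) else 1 - Λ (b u) (b v)

/-- The probability of the graph `G` under the conditional stochastic block model: independent
edges, `{u, v}` being present with probability `Λ (b u) (b v)`. -/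
def sbmProb {n K : ℕ} (Λ : Matrix (Fin K) (Fin K) ℝ) (b : Fin n → Fin K)
    (G : SimpleGraph (Fin n)) : ℝ :=
  ∏ p : Fin n × Fin n with p.1 < p.2, edgeFactor Λ b G p.1 p.2

open scoped Classical in
/-- The probability that a uniformly random `m`-element subset of the vertices satisfies `p`. -/
def seedProb (n m : ℕ) (p : Finset (Fin n) → Prop) : ℝ :=
  (#{S ∈ powersetCard m (univ : Finset (Fin n)) | p S} : ℝ) / (n.choose m : ℝ)

/-! ### Nomination lists, average precision, consistency -/

/-- A nomination list: an ordering of the nonseed vertices. Ranks start at `0`. -/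
abbrev NomList {n : ℕ} (S : Finset (Fin n)) : Type :=
  NonSeed S ≃ Fin (Fintype.card (NonSeed S))

/-- Average precision of a nomination list: the mean, over the first `numTarget b S` positions,
of the proportion of vertices of the block of interest among the vertices up to that position. -/
def AP {n K : ℕ} [NeZero K] (b : Fin n → Fin K) (S : Finset (Fin n)) (L : NomList S) : ℝ :=
  (1 / (numTarget b S : ℝ)) *
    ∑ i ∈ range (numTarget b S),
      ((univ.filter fun v : NonSeed S => (L v : ℕ) ≤ i ∧ b v = 0).card : ℝ) / ((i : ℝ) + 1)

/-- A nomination scheme: from the seed set and the graph it produces a finite set of lists (the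
admissible tie-breakings), from which the nomination list is drawn uniformly at random. -/
abbrev Scheme (n : ℕ) : Type :=
  (S : Finset (Fin n)) → SimpleGraph (Fin n) → Finset (NomList S)

open scoped Classical in
/-- Expected average precision of a scheme: the seed set is uniform among the `m`-element subsets,
independent of the block model graph, and ties are broken uniformly. -/
def EAP {n K : ℕ} [NeZero K] (Λ : Matrix (Fin K) (Fin K) ℝ) (b : Fin n → Fin K) (m : ℕ)
    (𝓛 : Scheme n) : ℝ :=
  ∑ S ∈ powersetCard m (univ : Finset (Fin n)), (1 / (n.choose m : ℝ)) *
    ∑ G : SimpleGraph (Fin n), sbmProb Λ b G *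
      ((∑ L ∈ 𝓛 S G, AP b S L) / (#(𝓛 S G) : ℝ))

/-- The feasible assignments: those with the block sizes of `b` that agree with `b` on the
seeds. -/
def feasible {n K : ℕ} (b : Fin n → Fin K) (S : Finset (Fin n)) : Finset (Fin n → Fin K) :=
  {φ | (∀ k, blockSize φ k = blockSize b k) ∧ ∀ i ∈ S, φ i = b i}

/-- Conditional probability that `v` belongs to the block of interest, given the graph and the
seed memberships, when all feasible assignments are equally likely a priori. -/
def posterior {n K : ℕ} [NeZero K] (Λ : Matrix (Fin K) (Fin K) ℝ) (b : Fin n → Fin K)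
    (S : Finset (Fin n)) (G : SimpleGraph (Fin n)) (v : Fin n) : ℝ :=
  (∑ φ ∈ feasible b S with φ v = 0, sbmProb Λ φ G) / ∑ φ ∈ feasible b S, sbmProb Λ φ G

open scoped Classical in
/-- The canonical nomination scheme, with known `Λ` and block sizes: the nonseeds are listed in
order of decreasing conditional probability of belonging to the block of interest. -/
def canonicalScheme {n K : ℕ} [NeZero K] (Λ : Matrix (Fin K) (Fin K) ℝ) (b : Fin n → Fin K) :
    Scheme n :=
  fun S G => {L | ∀ v w : NonSeed S, posterior Λ b S G w < posterior Λ b S G v → L v < L w}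

/-- Consistency of a sequence of nomination schemes: its expected average precision is
asymptotically that of the canonical scheme. -/
def IsConsistent {K : ℕ} [NeZero K] (Λ : Matrix (Fin K) (Fin K) ℝ)
    (b : (n : ℕ) → Fin n → Fin K) (m : ℕ → ℕ) (𝓛 : (n : ℕ) → Scheme n) : Prop :=
  Tendsto (fun n => |EAP Λ (b n) (m n) (canonicalScheme Λ (b n)) - EAP Λ (b n) (m n) (𝓛 n)|)
    atTop (𝓝 0)

/-! ### Estimates from the seeds -/

open scoped Classical in
/-- The estimate of `Λ`: observed edge densities within and between the seed blocks. -/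
def LambdaHat {n K : ℕ} (b : Fin n → Fin K) (S : Finset (Fin n)) (G : SimpleGraph (Fin n)) :
    Matrix (Fin K) (Fin K) ℝ :=
  fun k l =>
    if k = l then
      (#{p : Fin n × Fin n | p.1 < p.2 ∧ p.1 ∈ seedBlock b S k ∧ p.2 ∈ seedBlock b S k ∧
        G.Adj p.1 p.2} : ℝ) / ((#(seedBlock b S k)).choose 2 : ℝ)
    else
      (#{p : Fin n × Fin n | p.1 ∈ seedBlock b S k ∧ p.2 ∈ seedBlock b S l ∧
        G.Adj p.1 p.2} : ℝ) / ((#(seedBlock b S k) : ℝ) * (#(seedBlock b S l) : ℝ))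

/-- `nhat` is the vector of estimated block sizes `m_k n / m`, rounded (up or down) to integers
with sum `n`. -/
def IsSizeEstimate {n K : ℕ} (b : Fin n → Fin K) (S : Finset (Fin n)) (nhat : Fin K → ℕ) : Prop :=
  ∑ k, nhat k = n ∧ ∀ k, |(nhat k : ℝ) - (#(seedBlock b S k) : ℝ) * n / (#S : ℝ)| < 1

/-- `c` labels the vertices of the estimated log-odds matrix: seeds keep their observed blocks, and
block `k` has `nhat k` members. -/
def IsLabelling {n K : ℕ} (b : Fin n → Fin K) (S : Finset (Fin n)) (nhat : Fin K → ℕ)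
    (c : Fin n → Fin K) : Prop :=
  (∀ i ∈ S, c i = b i) ∧ ∀ k, blockSize c k = nhat k

/-- The log-odds matrix of the block probability matrix `Λ` and the labelling `c`. -/
def logOdds {n K : ℕ} (Λ : Matrix (Fin K) (Fin K) ℝ) (c : Fin n → Fin K) :
    Matrix (Fin n) (Fin n) ℝ :=
  fun i j => Real.log (Λ (c i) (c j) / (1 - Λ (c i) (c j)))

/-! ### Seeded graph matching and the maximum likelihood scheme -/

/-- The submatrix with rows from `S` and columns from the nonseeds. -/
def seedBlockMatrix {n : ℕ} (S : Finset (Fin n)) (M : Matrix (Fin n) (Fin n) ℝ) :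
    Matrix {v : Fin n // v ∈ S} (NonSeed S) ℝ :=
  M.submatrix (fun v => (v : Fin n)) (fun v => (v : Fin n))

/-- The submatrix with rows and columns from the nonseeds. -/
def nonSeedMatrix {n : ℕ} (S : Finset (Fin n)) (M : Matrix (Fin n) (Fin n) ℝ) :
    Matrix (NonSeed S) (NonSeed S) ℝ :=
  M.submatrix (fun v => (v : Fin n)) (fun v => (v : Fin n))

/-- The seeded graph matching objective
`-(1/2) tr (A₂₂ P B₂₂ᵀ Pᵀ) - tr (A₁₂ᵀ B₁₂ Pᵀ)`, with `P` the permutation matrix of `σ`. -/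
def matchObjective {n : ℕ} (S : Finset (Fin n)) (A B : Matrix (Fin n) (Fin n) ℝ)
    (σ : Equiv.Perm (NonSeed S)) : ℝ :=
  -(1 / 2) * (nonSeedMatrix S A * σ.permMatrix ℝ * (nonSeedMatrix S B).transpose *
      (σ.permMatrix ℝ).transpose).trace -
    ((seedBlockMatrix S A).transpose * seedBlockMatrix S B * (σ.permMatrix ℝ).transpose).trace

open scoped Classical in
/-- `σ` solves the seeded graph matching problem for the adjacency matrix of `G` and `B`. -/
def IsMatching {n : ℕ} (S : Finset (Fin n)) (G : SimpleGraph (Fin n))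
    (B : Matrix (Fin n) (Fin n) ℝ) (σ : Equiv.Perm (NonSeed S)) : Prop :=
  ∀ τ : Equiv.Perm (NonSeed S),
    matchObjective S (G.adjMatrix ℝ) B σ ≤ matchObjective S (G.adjMatrix ℝ) B τ

/-- The assignment given by a labelling `c` and a permutation `σ` of the nonseeds: the seeds keep
their label, and the nonseed `v` gets the label of `σ v`. -/
def matched {n K : ℕ} (S : Finset (Fin n)) (c : Fin n → Fin K) (σ : Equiv.Perm (NonSeed S)) :
    Fin n → Fin K :=
  fun v => if h : v ∈ S then c v else c (σ ⟨v, h⟩)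

/-- The likelihood of the assignment `ψ` on the pairs of vertices that are not both seeds. -/
def lik {n K : ℕ} (Λ : Matrix (Fin K) (Fin K) ℝ) (S : Finset (Fin n)) (G : SimpleGraph (Fin n))
    (ψ : Fin n → Fin K) : ℝ :=
  (∏ p : NonSeed S × NonSeed S with p.1 < p.2, edgeFactor Λ ψ G p.1 p.2) *
    ∏ p : {v : Fin n // v ∈ S} × NonSeed S, edgeFactor Λ ψ G p.1 p.2

/-- The likelihood ratio of `φ` with the labels of `i` and `j` exchanged, and `φ`. -/
def swapRatio {n K : ℕ} (Λ : Matrix (Fin K) (Fin K) ℝ) (S : Finset (Fin n))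
    (G : SimpleGraph (Fin n)) (φ : Fin n → Fin K) (i j : Fin n) : ℝ :=
  lik Λ S G (φ ∘ Equiv.swap i j) / lik Λ S G φ

/-- The score of a nonseed `i` with `φ i = 0`: the geometric mean of the likelihood ratios over
all exchanges with nonseeds outside block `0`. -/
def etaScore {n K : ℕ} [NeZero K] (Λ : Matrix (Fin K) (Fin K) ℝ) (S : Finset (Fin n))
    (G : SimpleGraph (Fin n)) (φ : Fin n → Fin K) (i : Fin n) : ℝ :=
  (∏ j ∈ univ.filter (fun j : NonSeed S => φ j ≠ 0), swapRatio Λ S G φ i j) ^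
    (1 / ((univ.filter fun j : NonSeed S => φ j ≠ 0).card : ℝ))

/-- The score of a nonseed `i` with `φ i ≠ 0`: the geometric mean of the likelihood ratios over
all exchanges with nonseeds in block `0`. -/
def xiScore {n K : ℕ} [NeZero K] (Λ : Matrix (Fin K) (Fin K) ℝ) (S : Finset (Fin n))
    (G : SimpleGraph (Fin n)) (φ : Fin n → Fin K) (i : Fin n) : ℝ :=
  (∏ j ∈ univ.filter (fun j : NonSeed S => φ j = 0), swapRatio Λ S G φ i j) ^
    (1 / ((univ.filter fun j : NonSeed S => φ j = 0).card : ℝ))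

/-- The lists that the maximum likelihood scheme may produce from the assignment `φ`: first the
nonseeds with `φ v = 0` in order of increasing `etaScore`, then those with `φ v ≠ 0` in order of
decreasing `xiScore`. -/
def IsMLList {n K : ℕ} [NeZero K] (Λ : Matrix (Fin K) (Fin K) ℝ) (S : Finset (Fin n))
    (G : SimpleGraph (Fin n)) (φ : Fin n → Fin K) (L : NomList S) : Prop :=
  ∀ v w : NonSeed S,
    (φ v = 0 → φ w ≠ 0 → L v < L w) ∧
    (φ v = 0 → φ w = 0 → etaScore Λ S G φ v < etaScore Λ S G φ w → L v < L w) ∧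
    (φ v ≠ 0 → φ w ≠ 0 → xiScore Λ S G φ w < xiScore Λ S G φ v → L v < L w)

open scoped Classical in
/-- The maximum likelihood scheme with estimated parameters. Here `c S` is the labelling of the
estimated log-odds matrix and `σ S G` is the solution of the graph matching problem that is
used. -/
def mlSchemeHat {n K : ℕ} [NeZero K] (b : Fin n → Fin K) (c : Finset (Fin n) → Fin n → Fin K)
    (σ : (S : Finset (Fin n)) → SimpleGraph (Fin n) → Equiv.Perm (NonSeed S)) : Scheme n :=
  fun S G => {L | IsMLList (LambdaHat b S G) S G (matched S (c S) (σ S G)) L}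

end

end VertexNomination

/-!
Both schemes are compared with the true assignment `b` through two events for the random graph,
given the seeds.

*Likelihood gap.* An assignment `ψ` that agrees with `b` on the seeds and differs from it on `d`
vertices changes the edge probability of at least `d * M` pairs, where `M` is the least number of
seeds in a block: a misplaced vertex and a seed of its own block form such a pair, because the
diagonal entries of `Λ` differ from the other entries of their rows. The Hellinger affinity of the
two graph distributions is therefore at most `r ^ (2 * d * M)` for some `r < 1`, and since `M` is
much larger than `log n`, a union bound over all `ψ` gives: with high probability every such `ψ` is
less likely than `b` by a factor `r ^ (2 * d * M)` (`graphProb_not_likelihoodGap_le`). In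
particular the posterior distribution concentrates on `b`, and the canonical list puts all the
targets first (`posterior_lt_of_likelihoodGap`).

*Accurate estimates.* By exponential moments the estimate of `Λ` is within a small multiple of
`M / n` of `Λ` (`graphProb_LambdaHat_tail`).

The graph matching objective is, up to terms that do not depend on the permutation, minus the
log-likelihood with estimated parameters, so the matched assignment `φ` maximizes that likelihood
among the assignments with the estimated block sizes (`orderedLogLik_le_of_isMatching`). One
competitor differs from `b` on at most `D` vertices, `D` being the total error of the estimated
block sizes (`exists_close_assignment`). A vertex lies in fewer than `n` pairs, so the competitor
loses at most a multiple of `D * n` in log-likelihood against `b`, whereas `φ` loses at least a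
multiple of `d * M`; hence `d` is at most of order `D * n / M` (`hammingDist_matched_le`).

The second moment of the hypergeometric distribution shows that `D` is at most of order
`√(n * u / m)` apart from rounding, for `m` seeds and `u` nonseeds
(`one_sub_le_seedProb_balanced`), and `M` is of order `m`. So `d / u` is at most of order
`n / (m * u) * (1 + √(n * u / m))`, which tends to zero when `m` is much larger than `n ^ (2 / 3)`
and `u` tends to infinity (`relative_error_le`); the latter follows from the existence of targets
when there are at least two blocks (`eventually_le_card_nonseed`). Finally, a list that starts with
the vertices labelled `0` by `φ` has average precision at least `1 - 2 * √(d / N)`, with `N` the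
number of targets, whatever the order inside the two groups (`one_sub_le_AP`). Hence both expected
average precisions tend to `1`, which also gives consistency.
-/

namespace VertexNomination

noncomputable section

/-! ### Sums over pairs of vertices and over graphs -/

theorem sum_lt_add_swap {n : ℕ} {M : Type*} [AddCommMonoid M] (f : Fin n × Fin n → M) :
    ∑ p : Fin n × Fin n with p.1 < p.2, (f p + f p.swap) + ∑ i, f (i, i) = ∑ p, f p := by
  have hswap : ∑ p : Fin n × Fin n with p.1 < p.2, f p.swap
      = ∑ p : Fin n × Fin n with p.2 < p.1, f p :=
    Finset.sum_nbij' Prod.swap Prod.swap (by simp) (by simp) (by simp) (by simp) (by simp)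
  have hdiag : ∑ i, f (i, i) = ∑ p : Fin n × Fin n with p.1 = p.2, f p :=
    Finset.sum_nbij' (fun i => (i, i)) Prod.fst (by simp) (by simp) (by simp)
      (by rintro ⟨i, j⟩; simp) (by simp)
  rw [sum_add_distrib, hswap, hdiag, ← sum_filter_add_sum_filter_not univ (fun p => p.1 < p.2) f,
    ← sum_filter_add_sum_filter_not (univ.filter fun p : Fin n × Fin n => ¬ p.1 < p.2)
      (fun p => p.2 < p.1) f, filter_filter, filter_filter, add_assoc]
  congr 3 <;> ext ⟨i, j⟩ <;> simp <;> grind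

open scoped Classical in
/-- Independence of the edges: summed over all graphs, a product over the pairs `u < v` of factors
depending on the adjacency of `u` and `v` factorizes. -/
theorem sum_graph_prod_ite {n : ℕ} (x y : Fin n × Fin n → ℝ) :
    ∑ G : SimpleGraph (Fin n), ∏ p : Fin n × Fin n with p.1 < p.2,
      (if G.Adj p.1 p.2 then x p else y p)
      = ∏ p : Fin n × Fin n with p.1 < p.2, (x p + y p) := by
  rw [prod_add]
  refine Finset.sum_bij' (fun G _ => univ.filter fun p : Fin n × Fin n => p.1 < p.2 ∧ G.Adj p.1 p.2)
    (fun t _ => SimpleGraph.fromRel fun u v => (u, v) ∈ t) ?_ (by simp) ?_ ?_ ?_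
  · intro G _
    simp only [mem_powerset]
    intro p
    simp only [mem_filter, mem_univ, true_and]
    exact And.left
  · intro G _
    ext u v
    simp only [SimpleGraph.fromRel_adj, mem_filter, mem_univ, true_and]
    constructor
    · rintro ⟨_, h | h⟩
      · exact h.2
      · exact h.2.symm
    · intro h
      refine ⟨h.ne, ?_⟩
      rcases lt_or_gt_of_ne h.ne with h1 | h1
      · exact Or.inl ⟨h1, h⟩
      · exact Or.inr ⟨h1, h.symm⟩
  · intro t ht
    rw [mem_powerset] at ht
    ext ⟨u, v⟩
    simp only [SimpleGraph.fromRel_adj, mem_filter, mem_univ, true_and]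
    constructor
    · rintro ⟨h1, _, h | h⟩
      · exact h
      · have := ht h
        simp only [mem_filter, mem_univ, true_and] at this
        exact absurd h1 this.asymm
    · intro h
      have := ht h
      simp only [mem_filter, mem_univ, true_and] at this
      exact ⟨this, this.ne, Or.inl h⟩
  · intro G _
    rw [prod_ite, filter_filter]
    congr 2
    ext ⟨u, v⟩
    simp only [mem_filter, mem_univ, true_and, Finset.mem_sdiff]
    tauto

/-! ### The stochastic block model -/

theorem edgeFactor_pos {n K : ℕ} {Λ : Matrix (Fin K) (Fin K) ℝ}
    (hΛ : ∀ k l, 0 < Λ k l ∧ Λ k l < 1) (ψ : Fin n → Fin K) (G : SimpleGraph (Fin n))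
    (u v : Fin n) : 0 < edgeFactor Λ ψ G u v := by
  unfold edgeFactor
  have := hΛ (ψ u) (ψ v)
  split_ifs <;> linarith

theorem sbmProb_pos {n K : ℕ} {Λ : Matrix (Fin K) (Fin K) ℝ}
    (hΛ : ∀ k l, 0 < Λ k l ∧ Λ k l < 1) (ψ : Fin n → Fin K) (G : SimpleGraph (Fin n)) :
    0 < sbmProb Λ ψ G :=
  prod_pos fun _ _ => edgeFactor_pos hΛ ψ G _ _

open scoped Classical in
theorem sum_sbmProb {n K : ℕ} (Λ : Matrix (Fin K) (Fin K) ℝ) (ψ : Fin n → Fin K) :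
    ∑ G : SimpleGraph (Fin n), sbmProb Λ ψ G = 1 := by
  have h := sum_graph_prod_ite (n := n) (fun p => Λ (ψ p.1) (ψ p.2))
    (fun p => 1 - Λ (ψ p.1) (ψ p.2))
  simpa [sbmProb, edgeFactor] using h

open scoped Classical in
/-- The probability under the block model that the graph satisfies `E`. -/
def graphProb {n K : ℕ} (Λ : Matrix (Fin K) (Fin K) ℝ) (ψ : Fin n → Fin K)
    (E : SimpleGraph (Fin n) → Prop) : ℝ :=
  ∑ G : SimpleGraph (Fin n) with E G, sbmProb Λ ψ G

section GraphProb

variable {n K : ℕ} {Λ : Matrix (Fin K) (Fin K) ℝ} (hΛ : ∀ k l, 0 < Λ k l ∧ Λ k l < 1)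
  (ψ : Fin n → Fin K)

theorem graphProb_eq_one (Λ : Matrix (Fin K) (Fin K) ℝ) {E : SimpleGraph (Fin n) → Prop}
    (h : ∀ G, E G) : graphProb Λ ψ E = 1 := by
  classical
  rw [graphProb, filter_true_of_mem fun G _ => h G, sum_sbmProb]

theorem graphProb_eq_one_sub_not (Λ : Matrix (Fin K) (Fin K) ℝ) (E : SimpleGraph (Fin n) → Prop) :
    graphProb Λ ψ E = 1 - graphProb Λ ψ fun G => ¬ E G := by
  classical
  rw [eq_sub_iff_add_eq, graphProb, graphProb, ← sum_sbmProb Λ ψ]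
  convert sum_filter_add_sum_filter_not univ E (fun G => sbmProb Λ ψ G)

include hΛ

theorem graphProb_mono {E F : SimpleGraph (Fin n) → Prop} (h : ∀ G, E G → F G) :
    graphProb Λ ψ E ≤ graphProb Λ ψ F := by
  classical
  refine sum_le_sum_of_subset_of_nonneg ?_ fun G _ _ => (sbmProb_pos hΛ ψ G).le
  intro G
  simpa using h G

theorem graphProb_or_le (E F : SimpleGraph (Fin n) → Prop) :
    graphProb Λ ψ (fun G => E G ∨ F G) ≤ graphProb Λ ψ E + graphProb Λ ψ F := by
  classical
  simp only [graphProb, sum_filter, ← sum_add_distrib]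
  refine sum_le_sum fun G _ => ?_
  have := (sbmProb_pos hΛ ψ G).le
  split_ifs <;> grind

theorem graphProb_exists_le {ι : Type*} [Fintype ι] (E : ι → SimpleGraph (Fin n) → Prop) :
    graphProb Λ ψ (fun G => ∃ i, E i G) ≤ ∑ i, graphProb Λ ψ (E i) := by
  classical
  simp only [graphProb, sum_filter]
  rw [sum_comm]
  refine sum_le_sum fun G _ => ?_
  have := (sbmProb_pos hΛ ψ G).le
  split_ifs with h
  · obtain ⟨i, hi⟩ := h
    refine le_trans (by rw [if_pos hi]) (single_le_sum (f := fun i => if E i G then _ else (0 : ℝ))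
      (fun j _ => ?_) (mem_univ i))
    split_ifs <;> simp [this]
  · exact sum_nonneg fun j _ => by split_ifs <;> simp [this]

/-- Markov's inequality. -/
theorem graphProb_le_sum (E : SimpleGraph (Fin n) → Prop) (X : SimpleGraph (Fin n) → ℝ)
    (hX : ∀ G, 0 ≤ X G) (h : ∀ G, E G → 1 ≤ X G) :
    graphProb Λ ψ E ≤ ∑ G : SimpleGraph (Fin n), sbmProb Λ ψ G * X G := by
  classical
  rw [graphProb, sum_filter]
  refine sum_le_sum fun G _ => ?_
  have := (sbmProb_pos hΛ ψ G).le
  split_ifs with hG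
  · exact le_mul_of_one_le_right this (h G hG)
  · exact mul_nonneg this (hX G)

end GraphProb

/-! ### Concentration of edge counts -/

theorem bernoulli_exp_le {q x : ℝ} (hq0 : 0 ≤ q) (hq1 : q ≤ 1) (hx : |x| ≤ 1) :
    q * Real.exp (x * (1 - q)) + (1 - q) * Real.exp (x * (0 - q)) ≤ Real.exp (x ^ 2) := by
  have hbound : ∀ y : ℝ, |y| ≤ 1 → Real.exp y ≤ 1 + y + y ^ 2 := fun y hy => by
    have := abs_le.1 (Real.abs_exp_sub_one_sub_id_le hy)
    linarith [this.2]
  have h1 := hbound (x * (1 - q)) (by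
    rw [abs_mul, abs_of_nonneg (by linarith : 0 ≤ 1 - q)]
    nlinarith [abs_nonneg x])
  have h2 := hbound (x * (0 - q)) (by
    rw [abs_mul, zero_sub, abs_neg, abs_of_nonneg hq0]
    nlinarith [abs_nonneg x])
  have h3 := Real.add_one_le_exp (x ^ 2)
  have h4 : q * (1 - q) ≤ 1 := by nlinarith
  nlinarith [mul_le_mul_of_nonneg_left h1 hq0,
    mul_le_mul_of_nonneg_left h2 (by linarith : 0 ≤ 1 - q),
    mul_le_mul_of_nonneg_right h4 (sq_nonneg x)]

open scoped Classical in
/-- Exponential moments of a weighted, centred edge count. -/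
theorem sum_sbmProb_mul_exp_le {n K : ℕ} {Λ : Matrix (Fin K) (Fin K) ℝ}
    (hΛ : ∀ k l, 0 < Λ k l ∧ Λ k l < 1) (ψ : Fin n → Fin K) (w : Fin n × Fin n → ℝ)
    (hw : ∀ p, |w p| ≤ 1) :
    ∑ G : SimpleGraph (Fin n), sbmProb Λ ψ G *
      Real.exp (∑ p : Fin n × Fin n with p.1 < p.2,
        w p * ((if G.Adj p.1 p.2 then 1 else 0) - Λ (ψ p.1) (ψ p.2)))
      ≤ Real.exp (∑ p : Fin n × Fin n with p.1 < p.2, w p ^ 2) := by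
  have h := sum_graph_prod_ite (n := n)
    (fun p => Λ (ψ p.1) (ψ p.2) * Real.exp (w p * (1 - Λ (ψ p.1) (ψ p.2))))
    (fun p => (1 - Λ (ψ p.1) (ψ p.2)) * Real.exp (w p * (0 - Λ (ψ p.1) (ψ p.2))))
  rw [Real.exp_sum]
  refine le_trans (le_of_eq ?_) (h.le.trans (prod_le_prod (fun p _ => ?_) fun p _ =>
    bernoulli_exp_le (hΛ _ _).1.le (hΛ _ _).2.le (hw p)))
  · refine sum_congr rfl fun G _ => ?_
    rw [Real.exp_sum, sbmProb, ← prod_mul_distrib]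
    refine prod_congr rfl fun p _ => ?_
    rw [edgeFactor]
    split_ifs <;> rfl
  · have := hΛ (ψ p.1) (ψ p.2)
    have h1 : 0 ≤ 1 - Λ (ψ p.1) (ψ p.2) := by linarith
    have := this.1.le
    positivity

open scoped Classical in
/-- Tail bound for a weighted edge count with weights in `[0, 2]` of total `W`, all the pairs of
positive weight having the same edge probability `q`. -/
theorem graphProb_weighted_count_tail {n K : ℕ} {Λ : Matrix (Fin K) (Fin K) ℝ}
    (hΛ : ∀ k l, 0 < Λ k l ∧ Λ k l < 1) (ψ : Fin n → Fin K) (w : Fin n × Fin n → ℝ)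
    (hw : ∀ p, 0 ≤ w p ∧ w p ≤ 2) (q : ℝ) (hq : ∀ p, w p ≠ 0 → Λ (ψ p.1) (ψ p.2) = q)
    {t W : ℝ} (ht : 0 < t) (ht1 : t ≤ 1)
    (hW : ∑ p : Fin n × Fin n with p.1 < p.2, w p = W) :
    graphProb Λ ψ (fun G => t * W < |∑ p : Fin n × Fin n with p.1 < p.2,
        w p * (if G.Adj p.1 p.2 then 1 else 0) - q * W|) ≤ 2 * Real.exp (-(t ^ 2 * W / 8)) := by
  -- Chernoff bound with parameter `t / 4`, for the deviation of sign `s`.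
  have key : ∀ s : ℝ, |s| = 1 → graphProb Λ ψ (fun G => t * W < s *
      (∑ p : Fin n × Fin n with p.1 < p.2, w p * (if G.Adj p.1 p.2 then 1 else 0) - q * W))
      ≤ Real.exp (-(t ^ 2 * W / 8)) := by
    intro s hs
    have hs2 : s ^ 2 = 1 := by rw [← sq_abs, hs]; norm_num
    have hrw : ∀ G : SimpleGraph (Fin n),
        ∑ p : Fin n × Fin n with p.1 < p.2, (t / 4 * s * w p) *
          ((if G.Adj p.1 p.2 then 1 else 0) - Λ (ψ p.1) (ψ p.2))
        = t / 4 * (s * (∑ p : Fin n × Fin n with p.1 < p.2,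
          w p * (if G.Adj p.1 p.2 then 1 else 0) - q * W)) := by
      intro G
      rw [← hW, mul_sum, ← sum_sub_distrib, mul_sum, mul_sum]
      refine sum_congr rfl fun p _ => ?_
      by_cases h0 : w p = 0
      · simp [h0]
      · rw [hq p h0]; ring
    have hM := sum_sbmProb_mul_exp_le hΛ ψ (fun p => t / 4 * s * w p) (fun p => by
      rw [abs_mul, abs_mul, hs, abs_of_pos (by positivity), abs_of_nonneg (hw p).1]
      nlinarith [hw p])
    simp only [hrw] at hM
    have hsq : ∑ p : Fin n × Fin n with p.1 < p.2, (t / 4 * s * w p) ^ 2 ≤ t ^ 2 / 8 * W := by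
      rw [← hW, mul_sum]
      refine sum_le_sum fun p _ => ?_
      rw [mul_pow, mul_pow, hs2]
      nlinarith [hw p, sq_nonneg t, mul_nonneg (sq_nonneg t)
        (mul_nonneg (hw p).1 (by linarith [(hw p).2] : 0 ≤ 2 - w p))]
    refine (graphProb_le_sum hΛ ψ _ (fun G => Real.exp (t / 4 * (s *
        (∑ p : Fin n × Fin n with p.1 < p.2, w p * (if G.Adj p.1 p.2 then 1 else 0) - q * W))
        - t ^ 2 / 4 * W)) (fun G => (Real.exp_pos _).le) (fun G hG => ?_)).trans ?_
    · rw [Real.one_le_exp_iff]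
      nlinarith [mul_lt_mul_of_pos_left hG ht]
    · simp only [Real.exp_sub, ← mul_div_assoc, ← sum_div]
      rw [div_le_iff₀ (Real.exp_pos _), ← Real.exp_add]
      exact hM.trans (Real.exp_le_exp.2 (hsq.trans (by linarith)))
  refine (graphProb_mono hΛ ψ fun G hG => ?_).trans ((graphProb_or_le hΛ ψ _ _).trans
    ((add_le_add (key 1 (by simp)) (key (-1) (by simp))).trans (two_mul _).symm.le))
  rcases lt_abs.1 hG with h | h
  · exact Or.inl (by linarith)
  · exact Or.inr (by linarith)

/-! ### Hellinger affinities and the likelihood gap -/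

/-- The Hellinger affinity of two Bernoulli distributions. -/
def affinity (p q : ℝ) : ℝ := √(p * q) + √((1 - p) * (1 - q))

theorem sqrt_mul_le_half_add {x y : ℝ} (hx : 0 ≤ x) (hy : 0 ≤ y) : √(x * y) ≤ (x + y) / 2 := by
  rw [Real.sqrt_le_left (by linarith)]
  nlinarith [sq_nonneg (x - y)]

theorem affinity_le_one {p q : ℝ} (hp : 0 < p ∧ p < 1) (hq : 0 < q ∧ q < 1) :
    affinity p q ≤ 1 := by
  have h1 := sqrt_mul_le_half_add hp.1.le hq.1.le
  have h2 := sqrt_mul_le_half_add (x := 1 - p) (y := 1 - q) (by linarith) (by linarith)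
  unfold affinity
  linarith

theorem affinity_lt_one {p q : ℝ} (hp : 0 < p ∧ p < 1) (hq : 0 < q ∧ q < 1) (hpq : p ≠ q) :
    affinity p q < 1 := by
  have h1 : √(p * q) < (p + q) / 2 := by
    rw [Real.sqrt_lt' (by linarith)]
    nlinarith [sq_pos_of_ne_zero (sub_ne_zero.2 hpq)]
  have h2 := sqrt_mul_le_half_add (x := 1 - p) (y := 1 - q) (by linarith) (by linarith)
  unfold affinity
  linarith

theorem affinity_pos {p q : ℝ} (hp : 0 < p ∧ p < 1) (hq : 0 < q ∧ q < 1) : 0 < affinity p q :=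
  add_pos_of_pos_of_nonneg (Real.sqrt_pos.2 (mul_pos hp.1 hq.1)) (Real.sqrt_nonneg _)

/-- A uniform bound `r ^ 2 < 1` for the affinities of the edge distributions at a seed of block `k`
of a vertex of block `k` and of a vertex of another block. -/
theorem exists_affinity_le {K : ℕ} [NeZero K] {Λ : Matrix (Fin K) (Fin K) ℝ}
    (hΛ : ∀ k l, 0 < Λ k l ∧ Λ k l < 1) (hsymm : Λ.IsSymm)
    (hdiag : ∀ k l, k ≠ l → Λ k k ≠ Λ k l) :
    ∃ r : ℝ, 0 < r ∧ r < 1 ∧ ∀ k l, k ≠ l → affinity (Λ l k) (Λ k k) ≤ r ^ 2 := by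
  obtain ⟨p, -, hp⟩ := exists_max_image (univ : Finset (Fin K × Fin K))
    (fun p => if p.1 = p.2 then 1 / 2 else affinity (Λ p.2 p.1) (Λ p.1 p.1))
    ⟨(0, 0), mem_univ _⟩
  have hlt : ∀ p : Fin K × Fin K,
      0 < (if p.1 = p.2 then 1 / 2 else affinity (Λ p.2 p.1) (Λ p.1 p.1)) ∧
      (if p.1 = p.2 then 1 / 2 else affinity (Λ p.2 p.1) (Λ p.1 p.1)) < 1 := by
    intro p
    split_ifs with h
    · norm_num
    · refine ⟨affinity_pos (hΛ _ _) (hΛ _ _), affinity_lt_one (hΛ _ _) (hΛ _ _) ?_⟩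
      rw [hsymm.apply p.1 p.2]
      exact (hdiag _ _ h).symm
  refine ⟨√(if p.1 = p.2 then 1 / 2 else affinity (Λ p.2 p.1) (Λ p.1 p.1)),
    Real.sqrt_pos.2 (hlt p).1, ?_, fun k l hkl => ?_⟩
  · rw [Real.sqrt_lt' one_pos]
    simpa using (hlt p).2
  · rw [Real.sq_sqrt (hlt p).1.le]
    simpa [hkl] using hp (k, l) (mem_univ _)

section Gap

variable {n K : ℕ} {Λ : Matrix (Fin K) (Fin K) ℝ} (hΛ : ∀ k l, 0 < Λ k l ∧ Λ k l < 1)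
  (hsymm : Λ.IsSymm) {b : Fin n → Fin K} {S : Finset (Fin n)} {M : ℕ}
  (hM : ∀ k, M ≤ #(seedBlock b S k))
  {r : ℝ} (hr0 : 0 < r) (hr1 : r < 1)
  (hr : ∀ k l, k ≠ l → affinity (Λ l k) (Λ k k) ≤ r ^ 2)

open scoped Classical in
theorem sum_sqrt_sbmProb (Λ : Matrix (Fin K) (Fin K) ℝ) (hΛ : ∀ k l, 0 < Λ k l ∧ Λ k l < 1)
    (ψ b : Fin n → Fin K) :
    ∑ G : SimpleGraph (Fin n), √(sbmProb Λ ψ G * sbmProb Λ b G) =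
      ∏ p : Fin n × Fin n with p.1 < p.2, affinity (Λ (ψ p.1) (ψ p.2)) (Λ (b p.1) (b p.2)) := by
  simp only [affinity]
  rw [← sum_graph_prod_ite]
  refine sum_congr rfl fun G _ => ?_
  rw [sbmProb, sbmProb, ← prod_mul_distrib, Real.sqrt_prod _
    fun p _ => (mul_pos (edgeFactor_pos hΛ ψ G _ _) (edgeFactor_pos hΛ b G _ _)).le]
  refine prod_congr rfl fun p _ => ?_
  rw [edgeFactor, edgeFactor]
  split_ifs <;> rfl

include hM in
/-- Every vertex that `ψ` misplaces contributes at least `M` pairs with a seed of its own block. -/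
theorem mul_hammingDist_le_sum (ψ : Fin n → Fin K) :
    M * hammingDist b ψ ≤ ∑ p : Fin n × Fin n,
      if b p.1 ≠ ψ p.1 ∧ p.2 ∈ seedBlock b S (b p.1) then 1 else 0 := by
  rw [Fintype.sum_prod_type, hammingDist, card_eq_sum_ones, mul_sum, sum_filter]
  refine sum_le_sum fun v _ => ?_
  by_cases h : b v = ψ v
  · simp [h]
  · simpa [h] using hM (b v)

include hΛ hsymm hM hr0 hr1 hr

theorem sum_sqrt_sbmProb_le {ψ : Fin n → Fin K} (hψ : ∀ i ∈ S, ψ i = b i) :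
    ∑ G : SimpleGraph (Fin n), √(sbmProb Λ ψ G * sbmProb Λ b G)
      ≤ (r ^ 2) ^ (M * hammingDist b ψ) := by
  classical
  have h2 : r ^ 2 ≤ 1 := by nlinarith
  set y : Fin n × Fin n → ℕ := fun p =>
    if b p.1 ≠ ψ p.1 ∧ p.2 ∈ seedBlock b S (b p.1) then 1 else 0 with hy
  have hdiag0 : ∑ i : Fin n, y (i, i) = 0 := by
    refine sum_eq_zero fun i _ => ?_
    simp only [hy, seedBlock, mem_filter]
    rw [if_neg]
    rintro ⟨h, h', -⟩
    exact h (hψ i h').symm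
  have hsum := sum_lt_add_swap y
  rw [hdiag0, add_zero] at hsum
  rw [sum_sqrt_sbmProb Λ hΛ]
  calc _ ≤ ∏ p : Fin n × Fin n with p.1 < p.2, (r ^ 2) ^ (y p + y p.swap) := by
        refine prod_le_prod (fun p _ => (affinity_pos (hΛ _ _) (hΛ _ _)).le) fun p _ => ?_
        by_cases h1 : b p.1 ≠ ψ p.1 ∧ p.2 ∈ seedBlock b S (b p.1)
        · have h1' := h1.2
          simp only [seedBlock, mem_filter] at h1'
          have h3 : y p.swap = 0 := if_neg fun h => h.1 (hψ _ h1'.1).symm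
          have h4 : y p = 1 := if_pos h1
          rw [h3, h4, hψ _ h1'.1, h1'.2, add_zero, pow_one]
          exact hr _ _ h1.1
        · have h4 : y p = 0 := if_neg h1
          by_cases h5 : b p.2 ≠ ψ p.2 ∧ p.1 ∈ seedBlock b S (b p.2)
          · have h5' := h5.2
            simp only [seedBlock, mem_filter] at h5'
            have h3 : y p.swap = 1 := if_pos h5
            rw [h3, h4, hψ _ h5'.1, h5'.2, zero_add, pow_one, hsymm.apply (ψ p.2) (b p.2)]
            exact hr _ _ h5.1
          · have h3 : y p.swap = 0 := if_neg h5
            rw [h3, h4, add_zero, pow_zero]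
            exact affinity_le_one (hΛ _ _) (hΛ _ _)
    _ = (r ^ 2) ^ (∑ p, y p) := by rw [prod_pow_eq_pow_sum, hsum]
    _ ≤ _ := pow_le_pow_of_le_one (by positivity) h2 (mul_hammingDist_le_sum hM ψ)

omit hΛ hsymm hM hr0 hr1 hr in
theorem sum_pow_hammingDist_le (b : Fin n → Fin K) {x : ℝ} (hx : 0 ≤ x) :
    ∑ ψ : Fin n → Fin K, x ^ hammingDist b ψ ≤ Real.exp (n * K * x) := by
  have h : ∀ ψ : Fin n → Fin K, x ^ hammingDist b ψ = ∏ v, if b v ≠ ψ v then x else 1 := by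
    intro ψ
    rw [hammingDist, prod_ite]
    simp
  calc ∑ ψ : Fin n → Fin K, x ^ hammingDist b ψ
      = ∏ v, ∑ k, (if b v ≠ k then x else 1) := by
        rw [Fintype.prod_sum]
        exact sum_congr rfl fun ψ _ => h ψ
    _ ≤ ∏ _v : Fin n, Real.exp (K * x) := by
        refine prod_le_prod (fun v _ => sum_nonneg fun k _ => by split_ifs <;> simp [hx])
          fun v _ => ?_
        calc ∑ k, (if b v ≠ k then x else 1) ≤ ∑ k, (x + if b v = k then 1 else 0) :=
              sum_le_sum fun k _ => by by_cases h : b v = k <;> simp [h, hx]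
          _ = K * x + 1 := by simp [sum_add_distrib]
          _ ≤ _ := Real.add_one_le_exp _
    _ = _ := by rw [prod_const, ← Real.exp_nat_mul, card_univ, Fintype.card_fin]; ring_nf

omit hΛ hsymm hM hr0 hr1 hr in
/-- Every assignment that agrees with `b` on the seeds is less likely than `b` by a factor
exponentially small in `M` times the number of vertices on which it differs from `b`. -/
def LikelihoodGap (Λ : Matrix (Fin K) (Fin K) ℝ) (b : Fin n → Fin K) (S : Finset (Fin n)) (M : ℕ)
    (r : ℝ) (G : SimpleGraph (Fin n)) : Prop :=
  ∀ ψ : Fin n → Fin K, (∀ i ∈ S, ψ i = b i) →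
    sbmProb Λ ψ G ≤ r ^ (2 * (M * hammingDist b ψ)) * sbmProb Λ b G

theorem graphProb_not_likelihoodGap_le :
    graphProb Λ b (fun G => ¬ LikelihoodGap Λ b S M r G) ≤ Real.exp (n * K * r ^ M) - 1 := by
  classical
  refine (graphProb_mono hΛ b (F := fun G => ∃ ψ : Fin n → Fin K, (∀ i ∈ S, ψ i = b i) ∧
    r ^ (2 * (M * hammingDist b ψ)) * sbmProb Λ b G < sbmProb Λ ψ G) fun G hG => ?_).trans ?_
  · simpa [LikelihoodGap] using hG
  refine (graphProb_exists_le hΛ b _).trans ?_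
  have hsum := sum_pow_hammingDist_le b (pow_nonneg hr0.le M)
  rw [← add_sum_erase _ _ (mem_univ b)] at hsum
  rw [← add_sum_erase _ _ (mem_univ b)]
  have hb0 : graphProb Λ b (fun G => (∀ i ∈ S, b i = b i) ∧
      r ^ (2 * (M * hammingDist b b)) * sbmProb Λ b G < sbmProb Λ b G) = 0 := by
    simp [graphProb]
  rw [hb0]
  have hterm : ∀ ψ ∈ univ.erase b, graphProb Λ b (fun G => (∀ i ∈ S, ψ i = b i) ∧
      r ^ (2 * (M * hammingDist b ψ)) * sbmProb Λ b G < sbmProb Λ ψ G)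
      ≤ (r ^ M) ^ hammingDist b ψ := by
    intro ψ _
    by_cases hψ : ∀ i ∈ S, ψ i = b i
    swap
    · simp only [hψ, false_and, graphProb, filter_false, sum_empty]
      positivity
    have hpos : 0 < r ^ (M * hammingDist b ψ) := by positivity
    refine (graphProb_le_sum hΛ b _ (fun G => √(sbmProb Λ ψ G * sbmProb Λ b G) /
      (r ^ (M * hammingDist b ψ) * sbmProb Λ b G))
      (fun G => div_nonneg (Real.sqrt_nonneg _) (mul_pos hpos (sbmProb_pos hΛ b G)).le)
      fun G hG => ?_).trans ?_
    · have hP := sbmProb_pos hΛ b G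
      rw [one_le_div (mul_pos hpos hP)]
      refine Real.le_sqrt_of_sq_le ?_
      have := mul_le_mul_of_nonneg_right hG.2.le hP.le
      calc _ = r ^ (2 * (M * hammingDist b ψ)) * sbmProb Λ b G * sbmProb Λ b G := by
            rw [mul_comm 2, pow_mul]; ring
        _ ≤ _ := this
    · have hrw : ∀ G : SimpleGraph (Fin n), sbmProb Λ b G * (√(sbmProb Λ ψ G * sbmProb Λ b G) /
          (r ^ (M * hammingDist b ψ) * sbmProb Λ b G))
          = √(sbmProb Λ ψ G * sbmProb Λ b G) / r ^ (M * hammingDist b ψ) := by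
        intro G
        have := (sbmProb_pos hΛ b G).ne'
        field_simp
      simp only [hrw, ← sum_div]
      rw [div_le_iff₀ hpos, ← pow_mul, ← pow_add, ← two_mul, pow_mul]
      exact sum_sqrt_sbmProb_le hΛ hsymm hM hr0 hr1 hr hψ
  have := sum_le_sum hterm
  simp only [hammingDist_self, pow_zero] at hsum
  linarith

omit hsymm hM hr in
/-- Under the likelihood gap, the posterior distribution concentrates on `b`. -/
theorem posterior_lt_of_likelihoodGap [NeZero K] {G : SimpleGraph (Fin n)}
    (hG : LikelihoodGap Λ b S M r G) (hsmall : Real.exp (n * K * r ^ M) < 2) {v w : Fin n}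
    (hv : b v = 0) (hw : b w ≠ 0) : posterior Λ b S G w < posterior Λ b S G v := by
  classical
  have hP := sbmProb_pos hΛ b G
  have hb : b ∈ feasible b S := by simp [feasible]
  have hrest : ∑ ψ ∈ (feasible b S).erase b, sbmProb Λ ψ G < sbmProb Λ b G := by
    have hsum := sum_pow_hammingDist_le b (pow_nonneg hr0.le M)
    rw [← add_sum_erase _ _ (mem_univ b), hammingDist_self, pow_zero] at hsum
    calc ∑ ψ ∈ (feasible b S).erase b, sbmProb Λ ψ G
        ≤ ∑ ψ ∈ (feasible b S).erase b, (r ^ M) ^ hammingDist b ψ * sbmProb Λ b G := by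
          refine sum_le_sum fun ψ hψ => ?_
          have hψ' : ∀ i ∈ S, ψ i = b i := by
            have := mem_of_mem_erase hψ
            simp only [feasible, mem_filter] at this
            exact this.2.2
          refine (hG ψ hψ').trans (mul_le_mul_of_nonneg_right ?_ hP.le)
          rw [← pow_mul]
          exact pow_le_pow_of_le_one hr0.le hr1.le (by omega)
      _ ≤ ∑ ψ ∈ univ.erase b, (r ^ M) ^ hammingDist b ψ * sbmProb Λ b G :=
          sum_le_sum_of_subset_of_nonneg (erase_subset_erase _ (subset_univ _))
            fun ψ _ _ => by positivity
      _ < 1 * sbmProb Λ b G := by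
          rw [← sum_mul]
          exact mul_lt_mul_of_pos_right (by linarith) hP
      _ = _ := one_mul _
  unfold posterior
  have hZ : 0 < ∑ ψ ∈ feasible b S, sbmProb Λ ψ G :=
    sum_pos (fun ψ _ => sbmProb_pos hΛ ψ G) ⟨b, hb⟩
  refine (div_lt_div_iff_of_pos_right hZ).2 ?_
  calc ∑ φ ∈ feasible b S with φ w = 0, sbmProb Λ φ G
      ≤ ∑ φ ∈ (feasible b S).erase b, sbmProb Λ φ G :=
        sum_le_sum_of_subset_of_nonneg (fun φ hφ => by
          rw [mem_filter] at hφ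
          exact mem_erase.2 ⟨fun h => hw (h ▸ hφ.2), hφ.1⟩)
          fun ψ _ _ => (sbmProb_pos hΛ ψ G).le
    _ < sbmProb Λ b G := hrest
    _ ≤ _ := single_le_sum (f := fun φ => sbmProb Λ φ G)
        (fun ψ _ => (sbmProb_pos hΛ ψ G).le) (mem_filter.2 ⟨hb, hv⟩)

end Gap

/-! ### The estimated block probabilities -/

section Estimate

variable {n K : ℕ} (b : Fin n → Fin K) (S : Finset (Fin n))

/-- Indicator of the ordered pairs in `S_k × S_l`. -/
def pairIndicator (k l : Fin K) (p : Fin n × Fin n) : ℝ :=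
  if p.1 ∈ seedBlock b S k ∧ p.2 ∈ seedBlock b S l then 1 else 0

theorem sum_pairIndicator (k l : Fin K) :
    ∑ p, pairIndicator b S k l p = (#(seedBlock b S k) : ℝ) * #(seedBlock b S l) := by
  simp only [pairIndicator]
  rw [sum_boole, ← Nat.cast_mul, ← card_product]
  congr 2
  ext p
  simp

theorem not_mem_seedBlock_of_ne {k l : Fin K} (h : k ≠ l) {v : Fin n}
    (hk : v ∈ seedBlock b S k) : v ∉ seedBlock b S l := by
  simp only [seedBlock, mem_filter] at *
  rintro ⟨_, h'⟩
  exact h (hk.2.symm.trans h')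

theorem sum_pairIndicator_diag (k l : Fin K) :
    ∑ i, pairIndicator b S k l (i, i) = if k = l then (#(seedBlock b S k) : ℝ) else 0 := by
  simp only [pairIndicator]
  split_ifs with h
  · subst h
    simp
  · exact sum_eq_zero fun i _ => if_neg fun h' => not_mem_seedBlock_of_ne b S h h'.1 h'.2

/-- The number of ordered pairs of distinct vertices in `S_k × S_l`. -/
def pairCount (k l : Fin K) : ℝ :=
  (#(seedBlock b S k) : ℝ) * #(seedBlock b S l) - if k = l then (#(seedBlock b S k) : ℝ) else 0

theorem sum_lt_pairIndicator (k l : Fin K) :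
    ∑ p : Fin n × Fin n with p.1 < p.2, (pairIndicator b S k l p + pairIndicator b S k l p.swap)
      = pairCount b S k l := by
  rw [pairCount, ← sum_pairIndicator, ← sum_pairIndicator_diag, eq_sub_iff_add_eq]
  exact sum_lt_add_swap _

theorem half_sq_le_pairCount {M : ℕ} (hM : ∀ k, M ≤ #(seedBlock b S k)) (hM2 : 2 ≤ M)
    (k l : Fin K) : (M : ℝ) ^ 2 / 2 ≤ pairCount b S k l := by
  have hk : (M : ℝ) ≤ #(seedBlock b S k) := by exact_mod_cast hM k
  have hl : (M : ℝ) ≤ #(seedBlock b S l) := by exact_mod_cast hM l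
  have h2 : (2 : ℝ) ≤ M := by exact_mod_cast hM2
  unfold pairCount
  split_ifs with h
  · subst h
    nlinarith
  · nlinarith

open scoped Classical in
/-- Both kinds of entries of the estimate are weighted edge counts over the pairs `u < v`, divided
by the total weight; inside a block each pair has weight `2`. -/
theorem LambdaHat_eq (G : SimpleGraph (Fin n)) (k l : Fin K) (h0 : pairCount b S k l ≠ 0) :
    LambdaHat b S G k l = (∑ p : Fin n × Fin n with p.1 < p.2,
      (pairIndicator b S k l p + pairIndicator b S k l p.swap) *
        (if G.Adj p.1 p.2 then 1 else 0)) / pairCount b S k l := by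
  unfold LambdaHat
  split_ifs with hkl
  · subst hkl
    have hnum : ∑ p : Fin n × Fin n with p.1 < p.2,
        (pairIndicator b S k k p + pairIndicator b S k k p.swap) *
          (if G.Adj p.1 p.2 then 1 else 0)
        = 2 * (#{p : Fin n × Fin n | p.1 < p.2 ∧ p.1 ∈ seedBlock b S k ∧ p.2 ∈ seedBlock b S k ∧
        G.Adj p.1 p.2} : ℝ) := by
      rw [← sum_boole, mul_sum, sum_filter]
      refine sum_congr rfl fun p _ => ?_
      simp only [pairIndicator, Prod.fst_swap, Prod.snd_swap]
      by_cases h1 : p.1 < p.2 <;> by_cases h2 : p.1 ∈ seedBlock b S k <;>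
        by_cases h3 : p.2 ∈ seedBlock b S k <;> by_cases h4 : G.Adj p.1 p.2 <;>
        simp [h1, h2, h3, h4]
      norm_num
    rw [hnum, Nat.cast_choose_two]
    unfold pairCount at *
    rw [if_pos rfl] at *
    rw [show (#(seedBlock b S k) : ℝ) * #(seedBlock b S k) - #(seedBlock b S k)
      = 2 * ((#(seedBlock b S k) : ℝ) * (#(seedBlock b S k) - 1) / 2) by ring,
      mul_div_mul_left _ _ two_ne_zero]
  · have hnum : ∑ p : Fin n × Fin n with p.1 < p.2,
        (pairIndicator b S k l p + pairIndicator b S k l p.swap) *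
          (if G.Adj p.1 p.2 then 1 else 0)
        = (#{p : Fin n × Fin n | p.1 ∈ seedBlock b S k ∧ p.2 ∈ seedBlock b S l ∧
        G.Adj p.1 p.2} : ℝ) := by
      rw [← sum_boole, ← sum_lt_add_swap]
      simp only [SimpleGraph.irrefl, and_false, if_false, sum_const_zero, add_zero]
      refine sum_congr rfl fun p _ => ?_
      simp only [pairIndicator, Prod.fst_swap, Prod.snd_swap, G.adj_comm p.2 p.1, add_mul,
        ite_mul, one_mul, zero_mul, ← ite_and, and_assoc]
    rw [hnum, pairCount, if_neg hkl, sub_zero]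

theorem LambdaHat_symm (G : SimpleGraph (Fin n)) (k l : Fin K) :
    LambdaHat b S G k l = LambdaHat b S G l k := by
  classical
  unfold LambdaHat
  by_cases h : k = l
  · rw [if_pos h, if_pos h.symm, h]
  · rw [if_neg h, if_neg (Ne.symm h), mul_comm]
    congr 2
    refine card_nbij' Prod.swap Prod.swap ?_ ?_ (fun _ _ => Prod.swap_swap _)
      (fun _ _ => Prod.swap_swap _)
    · rintro p hp
      simp only [coe_filter, Set.mem_ofPred_eq, mem_univ, true_and] at *
      exact ⟨hp.2.1, hp.1, hp.2.2.symm⟩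
    · rintro p hp
      simp only [coe_filter, Set.mem_ofPred_eq, mem_univ, true_and] at *
      exact ⟨hp.2.1, hp.1, hp.2.2.symm⟩

/-- The estimate is uniformly within `t` of the block probability matrix, outside an event of
probability exponentially small in `(t M) ^ 2`. -/
theorem graphProb_LambdaHat_tail {Λ : Matrix (Fin K) (Fin K) ℝ}
    (hΛ : ∀ k l, 0 < Λ k l ∧ Λ k l < 1) (hsymm : Λ.IsSymm) {M : ℕ}
    (hM : ∀ k, M ≤ #(seedBlock b S k)) (hM2 : 2 ≤ M) {t : ℝ} (ht : 0 < t) (ht1 : t ≤ 1) :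
    graphProb Λ b (fun G => ¬ ∀ k l, |LambdaHat b S G k l - Λ k l| ≤ t)
      ≤ 2 * K ^ 2 * Real.exp (-((t * M) ^ 2 / 16)) := by
  classical
  refine (graphProb_mono hΛ b (F := fun G => ∃ q : Fin K × Fin K,
    t < |LambdaHat b S G q.1 q.2 - Λ q.1 q.2|) fun G hG => ?_).trans
    ((graphProb_exists_le hΛ b _).trans ?_)
  · push Not at hG
    obtain ⟨k, l, h⟩ := hG
    exact ⟨(k, l), h⟩
  have hterm : ∀ q : Fin K × Fin K,
      graphProb Λ b (fun G => t < |LambdaHat b S G q.1 q.2 - Λ q.1 q.2|)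
        ≤ 2 * Real.exp (-((t * M) ^ 2 / 16)) := by
    rintro ⟨k, l⟩
    have hW := half_sq_le_pairCount b S hM hM2 k l
    have hW0 : 0 < pairCount b S k l := lt_of_lt_of_le (by positivity) hW
    refine ((graphProb_mono hΛ b fun G hG => ?_).trans
      (graphProb_weighted_count_tail hΛ b
        (fun p => pairIndicator b S k l p + pairIndicator b S k l p.swap) ?_ (Λ k l) ?_ ht ht1
        (sum_lt_pairIndicator b S k l))).trans ?_
    · dsimp only at hG
      rw [LambdaHat_eq b S G k l hW0.ne', div_sub' hW0.ne', abs_div, abs_of_pos hW0,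
        lt_div_iff₀ hW0, mul_comm (pairCount b S k l)] at hG
      exact hG
    · intro p
      simp only [pairIndicator]
      constructor <;> split_ifs <;> norm_num
    · intro p hp
      simp only [pairIndicator, seedBlock, mem_filter, Prod.fst_swap, Prod.snd_swap] at hp
      by_cases h1 : (p.1 ∈ S ∧ b p.1 = k) ∧ p.2 ∈ S ∧ b p.2 = l
      · rw [h1.1.2, h1.2.2]
      · by_cases h2 : (p.2 ∈ S ∧ b p.2 = k) ∧ p.1 ∈ S ∧ b p.1 = l
        · rw [h2.1.2, h2.2.2, hsymm.apply]
        · simp [h1, h2] at hp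
    · refine mul_le_mul_of_nonneg_left (Real.exp_le_exp.2 ?_) zero_le_two
      nlinarith [mul_le_mul_of_nonneg_left hW (sq_nonneg t)]
  refine (sum_le_sum fun q _ => hterm q).trans (le_of_eq ?_)
  rw [sum_const, card_univ, Fintype.card_prod, Fintype.card_fin, nsmul_eq_mul]
  push_cast
  ring

end Estimate

/-! ### Graph matching maximizes the likelihood -/

theorem exists_perm_comp_eq {α κ : Type*} [Fintype α] [DecidableEq κ] (f g : α → κ)
    (h : ∀ k, #{a | f a = k} = #{a | g a = k}) : ∃ π : Equiv.Perm α, ∀ a, g (π a) = f a := by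
  have e : ∀ k, {a // f a = k} ≃ {a // g a = k} := fun k =>
    Fintype.equivOfCardEq (by rw [Fintype.card_subtype, Fintype.card_subtype]; exact h k)
  exact ⟨Equiv.ofFiberEquiv e, Equiv.ofFiberEquiv_map e⟩

section Matching

variable {n K : ℕ} (S : Finset (Fin n))

theorem sum_eq_sum_seed_add_sum_nonseed {M : Type*} [AddCommMonoid M] (f : Fin n → M) :
    ∑ v, f v = ∑ v : {v : Fin n // v ∈ S}, f v + ∑ v : NonSeed S, f v := by
  rw [← Fintype.sum_subtype_add_sum_subtype (fun v => v ∈ S) f]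
  congr!

variable {S}

theorem matched_of_mem {c : Fin n → Fin K} (τ : Equiv.Perm (NonSeed S)) {v : Fin n} (h : v ∈ S) :
    matched S c τ v = c v := by
  simp [matched, h]

theorem matched_nonseed {c : Fin n → Fin K} (τ : Equiv.Perm (NonSeed S)) (v : NonSeed S) :
    matched S c τ v = c (τ v) := by
  simp [matched, v.2]

theorem blockSize_eq_sum (ψ : Fin n → Fin K) (k : Fin K) :
    blockSize ψ k = ∑ v, if ψ v = k then 1 else 0 := by
  rw [blockSize, card_filter]

theorem blockSize_matched (c : Fin n → Fin K) (τ : Equiv.Perm (NonSeed S)) (k : Fin K) :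
    blockSize (matched S c τ) k = blockSize c k := by
  rw [blockSize_eq_sum, blockSize_eq_sum, sum_eq_sum_seed_add_sum_nonseed S,
    sum_eq_sum_seed_add_sum_nonseed S fun v => if c v = k then 1 else 0]
  congr 1
  · exact sum_congr rfl fun v _ => by rw [matched_of_mem τ v.2]
  · simp only [matched_nonseed]
    exact Equiv.sum_comp τ fun v : NonSeed S => if c v = k then 1 else 0

theorem exists_matched_eq {c ψ : Fin n → Fin K} (hS : ∀ i ∈ S, ψ i = c i)
    (hsize : ∀ k, blockSize ψ k = blockSize c k) :
    ∃ τ : Equiv.Perm (NonSeed S), matched S c τ = ψ := by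
  obtain ⟨τ, hτ⟩ := exists_perm_comp_eq (fun v : NonSeed S => ψ v) (fun v : NonSeed S => c v)
    (fun k => by
      have h := hsize k
      rw [blockSize_eq_sum, blockSize_eq_sum, sum_eq_sum_seed_add_sum_nonseed S,
        sum_eq_sum_seed_add_sum_nonseed S fun v => if c v = k then 1 else 0,
        sum_congr rfl fun (v : {v : Fin n // v ∈ S}) _ => by rw [hS v v.2]] at h
      rw [card_filter, card_filter]
      exact Nat.add_left_cancel h)
  refine ⟨τ, funext fun v => ?_⟩
  by_cases hv : v ∈ S
  · rw [matched_of_mem τ hv, hS v hv]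
  · exact (matched_nonseed τ ⟨v, hv⟩).trans (hτ ⟨v, hv⟩)

theorem mul_permMatrix_transpose_apply {ι α : Type*} [Fintype α] [DecidableEq α]
    (M : Matrix ι α ℝ) (τ : Equiv.Perm α) (i : ι) (j : α) :
    (M * (τ.permMatrix ℝ).transpose) i j = M i (τ j) := by
  simp [Matrix.mul_apply, Equiv.Perm.permMatrix, PEquiv.toMatrix_apply, Equiv.symm_apply_eq]

theorem permMatrix_mul_apply {ι α : Type*} [Fintype α] [DecidableEq α]
    (M : Matrix α ι ℝ) (τ : Equiv.Perm α) (i : α) (j : ι) :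
    (τ.permMatrix ℝ * M) i j = M (τ i) j := by
  simp [Matrix.mul_apply, Equiv.Perm.permMatrix, PEquiv.toMatrix_apply]

open scoped Classical in
/-- Sum of the log-odds of the ends of the edges of `G`, over ordered pairs of vertices. -/
def energy (Λ : Matrix (Fin K) (Fin K) ℝ) (G : SimpleGraph (Fin n)) (ψ : Fin n → Fin K) : ℝ :=
  ∑ i, ∑ j, (if G.Adj i j then 1 else 0) * logOdds Λ ψ i j

open scoped Classical in
/-- Up to a term that does not depend on the permutation, the matching objective is minus half the
energy of the matched assignment. -/
theorem matchObjective_eq {Λ : Matrix (Fin K) (Fin K) ℝ} (hΛ : ∀ k l, Λ k l = Λ l k)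
    (G : SimpleGraph (Fin n)) (c : Fin n → Fin K) (τ : Equiv.Perm (NonSeed S)) :
    matchObjective S (G.adjMatrix ℝ) (logOdds Λ c) τ = -(1 / 2) * energy Λ G (matched S c τ) +
      (1 / 2) * ∑ i : {v : Fin n // v ∈ S}, ∑ j : {v : Fin n // v ∈ S},
        (if G.Adj i j then 1 else 0) * logOdds Λ c i j := by
  have h1 : (nonSeedMatrix S (G.adjMatrix ℝ) * τ.permMatrix ℝ *
      (nonSeedMatrix S (logOdds Λ c)).transpose * (τ.permMatrix ℝ).transpose).trace
      = ∑ i : NonSeed S, ∑ j : NonSeed S, (if G.Adj i j then 1 else 0) *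
        logOdds Λ (matched S c τ) i j := by
    rw [Matrix.mul_assoc (nonSeedMatrix S (G.adjMatrix ℝ)), Matrix.trace]
    refine sum_congr rfl fun i _ => ?_
    rw [Matrix.diag_apply, mul_permMatrix_transpose_apply, Matrix.mul_apply]
    refine sum_congr rfl fun j _ => ?_
    rw [permMatrix_mul_apply]
    simp [nonSeedMatrix, logOdds, matched_nonseed]
  have h2 : ((seedBlockMatrix S (G.adjMatrix ℝ)).transpose * seedBlockMatrix S (logOdds Λ c) *
      (τ.permMatrix ℝ).transpose).trace
      = ∑ i : {v : Fin n // v ∈ S}, ∑ j : NonSeed S, (if G.Adj i j then 1 else 0) *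
        logOdds Λ (matched S c τ) i j := by
    rw [Matrix.trace, sum_comm]
    refine sum_congr rfl fun j _ => ?_
    rw [Matrix.diag_apply, mul_permMatrix_transpose_apply, Matrix.mul_apply]
    refine sum_congr rfl fun i _ => ?_
    rw [logOdds, matched_of_mem τ i.2, matched_nonseed]
    simp [seedBlockMatrix, logOdds, G.adj_comm]
  have h3 : ∑ i : NonSeed S, ∑ j : {v : Fin n // v ∈ S}, (if G.Adj i j then 1 else 0) *
        logOdds Λ (matched S c τ) i j = ∑ i : {v : Fin n // v ∈ S}, ∑ j : NonSeed S,
        (if G.Adj i j then 1 else 0) * logOdds Λ (matched S c τ) i j := by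
    rw [sum_comm]
    refine sum_congr rfl fun i _ => sum_congr rfl fun j _ => ?_
    rw [G.adj_comm, logOdds, logOdds, hΛ]
  have h4 : ∑ i : {v : Fin n // v ∈ S}, ∑ j : {v : Fin n // v ∈ S},
        (if G.Adj i j then 1 else 0) * logOdds Λ (matched S c τ) i j
      = ∑ i : {v : Fin n // v ∈ S}, ∑ j : {v : Fin n // v ∈ S},
        (if G.Adj i j then 1 else 0) * logOdds Λ c i j := by
    refine sum_congr rfl fun i _ => sum_congr rfl fun j _ => ?_
    rw [logOdds, logOdds, matched_of_mem τ i.2, matched_of_mem τ j.2]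
  rw [matchObjective, h1, h2, energy, sum_eq_sum_seed_add_sum_nonseed S]
  simp only [sum_eq_sum_seed_add_sum_nonseed S (fun j => (if G.Adj _ j then (1 : ℝ) else 0) *
    logOdds Λ (matched S c τ) _ j), sum_add_distrib]
  rw [h3, h4]
  ring

/-- Twice the log-likelihood, written as a sum over the ordered pairs of distinct vertices. -/
def orderedLogLik (Λ : Matrix (Fin K) (Fin K) ℝ) (G : SimpleGraph (Fin n)) (ψ : Fin n → Fin K) :
    ℝ :=
  ∑ p : Fin n × Fin n, if p.1 = p.2 then 0 else Real.log (edgeFactor Λ ψ G p.1 p.2)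

theorem orderedLogLik_eq {Λ : Matrix (Fin K) (Fin K) ℝ} (hsymm : ∀ k l, Λ k l = Λ l k)
    (hΛ : ∀ k l, 0 < Λ k l ∧ Λ k l < 1) (G : SimpleGraph (Fin n)) (ψ : Fin n → Fin K) :
    orderedLogLik Λ G ψ = 2 * Real.log (sbmProb Λ ψ G) := by
  rw [orderedLogLik, ← sum_lt_add_swap, sbmProb,
    Real.log_prod fun p _ => (edgeFactor_pos hΛ ψ G _ _).ne', mul_sum]
  simp only [if_true, sum_const_zero, add_zero]
  refine sum_congr rfl fun p hp => ?_
  have hne : p.1 ≠ p.2 := (mem_filter.1 hp).2.ne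
  have hsw : edgeFactor Λ ψ G p.2 p.1 = edgeFactor Λ ψ G p.1 p.2 := by
    classical
    simp only [edgeFactor, hsymm (ψ p.2)]
    exact if_congr (G.adj_comm _ _) rfl rfl
  simp only [Prod.fst_swap, Prod.snd_swap, if_neg hne, if_neg hne.symm, hsw]
  ring

theorem orderedLogLik_eq_energy_add {Λ : Matrix (Fin K) (Fin K) ℝ}
    (hΛ : ∀ k l, 0 < Λ k l ∧ Λ k l < 1) (G : SimpleGraph (Fin n)) (ψ : Fin n → Fin K) :
    orderedLogLik Λ G ψ = energy Λ G ψ +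
      ∑ p : Fin n × Fin n, if p.1 = p.2 then 0 else Real.log (1 - Λ (ψ p.1) (ψ p.2)) := by
  classical
  rw [orderedLogLik, energy, ← Fintype.sum_prod_type', ← sum_add_distrib]
  refine sum_congr rfl fun p _ => ?_
  have h := hΛ (ψ p.1) (ψ p.2)
  by_cases hp : p.1 = p.2
  · simp [hp]
  · by_cases hA : G.Adj p.1 p.2
    · simp only [if_neg hp, edgeFactor, if_pos hA, logOdds]
      rw [Real.log_div h.1.ne' (by linarith [h.2])]
      ring
    · simp [hp, edgeFactor, hA]

/-- Among the assignments that agree with `c` on the seeds and have its block sizes, the matched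
one maximizes the likelihood. -/
theorem orderedLogLik_le_of_isMatching {Λ : Matrix (Fin K) (Fin K) ℝ}
    (hsymm : ∀ k l, Λ k l = Λ l k) (hΛ : ∀ k l, 0 < Λ k l ∧ Λ k l < 1) {G : SimpleGraph (Fin n)}
    {c ψ : Fin n → Fin K} {σ : Equiv.Perm (NonSeed S)} (hσ : IsMatching S G (logOdds Λ c) σ)
    (hS : ∀ i ∈ S, ψ i = c i) (hsize : ∀ k, blockSize ψ k = blockSize c k) :
    orderedLogLik Λ G ψ ≤ orderedLogLik Λ G (matched S c σ) := by
  classical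
  obtain ⟨τ, rfl⟩ := exists_matched_eq hS hsize
  have h := hσ τ
  -- The non-edge part of the likelihood depends on the block sizes only.
  obtain ⟨π, hπ⟩ := exists_perm_comp_eq (matched S c τ) (matched S c σ) fun k => by
    rw [← blockSize, ← blockSize, blockSize_matched, blockSize_matched]
  have hrest : ∑ p : Fin n × Fin n, (if p.1 = p.2 then 0 else
        Real.log (1 - Λ (matched S c τ p.1) (matched S c τ p.2)))
      = ∑ p : Fin n × Fin n, (if p.1 = p.2 then 0 else
        Real.log (1 - Λ (matched S c σ p.1) (matched S c σ p.2))) := by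
    refine Eq.trans (sum_congr rfl fun p _ => ?_) (Equiv.sum_comp (Equiv.prodCongr π π) _)
    simp [hπ]
  rw [orderedLogLik_eq_energy_add hΛ, orderedLogLik_eq_energy_add hΛ, hrest]
  have h1 := matchObjective_eq hsymm G c τ
  have h2 := matchObjective_eq hsymm G c σ
  have h3 : matchObjective S (G.adjMatrix ℝ) (logOdds Λ c) σ
      ≤ matchObjective S (G.adjMatrix ℝ) (logOdds Λ c) τ := by convert h
  linarith

end Matching

/-! ### Changing the parameters and the block sizes -/

section Perturbation

variable {n K : ℕ}

theorem abs_sum_pair_le {ψ ψ' : Fin n → Fin K} (h : Fin n × Fin n → ℝ) {B : ℝ} (hB : 0 ≤ B)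
    (hh : ∀ p, |h p| ≤ B) (h0 : ∀ p : Fin n × Fin n, ψ p.1 = ψ' p.1 → ψ p.2 = ψ' p.2 → h p = 0) :
    |∑ p, h p| ≤ B * (2 * n * hammingDist ψ ψ') := by
  have h1 : ∀ p : Fin n × Fin n, |h p| ≤
      B * (if ψ p.1 ≠ ψ' p.1 then 1 else 0) + B * (if ψ p.2 ≠ ψ' p.2 then 1 else 0) := by
    intro p
    by_cases h1 : ψ p.1 = ψ' p.1
    · by_cases h2 : ψ p.2 = ψ' p.2
      · simp [h0 p h1 h2, h1, h2]
      · simpa [h1, h2] using hh p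
    · have := hh p
      by_cases h2 : ψ p.2 = ψ' p.2 <;> simp [h1, h2] <;> linarith
  refine (abs_sum_le_sum_abs _ _).trans ((sum_le_sum fun p _ => h1 p).trans (le_of_eq ?_))
  have e1 := Fintype.sum_prod_type' fun (x : Fin n) (_ : Fin n) =>
    if ψ x ≠ ψ' x then (1 : ℝ) else 0
  have e2 := Fintype.sum_prod_type' fun (_ : Fin n) (y : Fin n) =>
    if ψ y ≠ ψ' y then (1 : ℝ) else 0
  simp only [sum_const, card_univ, Fintype.card_fin, nsmul_eq_mul, ← mul_sum, sum_boole] at e1 e2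
  rw [sum_add_distrib, ← mul_sum, ← mul_sum, sum_boole, sum_boole, e1, e2, hammingDist]
  ring

theorem abs_log_sub_log_le {x y m : ℝ} (hm : 0 < m) (hx : m ≤ x) (hy : m ≤ y) :
    |Real.log x - Real.log y| ≤ |x - y| / m := by
  wlog hxy : y ≤ x generalizing x y
  · rw [abs_sub_comm, abs_sub_comm x]
    exact this hy hx (le_of_not_ge hxy)
  have hx0 := hm.trans_le hx
  have hy0 := hm.trans_le hy
  rw [abs_of_nonneg (sub_nonneg.2 (Real.log_le_log hy0 hxy)), abs_of_nonneg (sub_nonneg.2 hxy),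
    ← Real.log_div hx0.ne' hy0.ne']
  calc Real.log (x / y) ≤ x / y - 1 := Real.log_le_sub_one_of_pos (div_pos hx0 hy0)
    _ = (x - y) / y := by field_simp
    _ ≤ _ := div_le_div_of_nonneg_left (sub_nonneg.2 hxy) hm hy

theorem edgeFactor_mem {Λ : Matrix (Fin K) (Fin K) ℝ} {δ : ℝ}
    (hδ : ∀ k l, δ ≤ Λ k l ∧ Λ k l ≤ 1 - δ) (G : SimpleGraph (Fin n)) (ψ : Fin n → Fin K)
    (u v : Fin n) : δ ≤ edgeFactor Λ ψ G u v ∧ edgeFactor Λ ψ G u v ≤ 1 - δ := by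
  have := hδ (ψ u) (ψ v)
  unfold edgeFactor
  split_ifs
  · exact this
  · constructor <;> linarith

theorem orderedLogLik_sub_le {Λ : Matrix (Fin K) (Fin K) ℝ} {δ : ℝ} (hδ0 : 0 < δ)
    (hδ : ∀ k l, δ ≤ Λ k l ∧ Λ k l ≤ 1 - δ) (G : SimpleGraph (Fin n)) (ψ ψ' : Fin n → Fin K) :
    |orderedLogLik Λ G ψ - orderedLogLik Λ G ψ'|
      ≤ Real.log (1 / δ) * (2 * n * hammingDist ψ ψ') := by
  have hlog : ∀ (φ : Fin n → Fin K) u v, Real.log δ ≤ Real.log (edgeFactor Λ φ G u v) ∧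
      Real.log (edgeFactor Λ φ G u v) ≤ 0 := by
    intro φ u v
    have := edgeFactor_mem hδ G φ u v
    exact ⟨Real.log_le_log hδ0 this.1, Real.log_nonpos (by linarith) (by linarith)⟩
  by_cases hn : n = 0
  · subst hn
    simp [orderedLogLik]
  have hpos : 0 ≤ Real.log (1 / δ) := by
    have := hlog ψ ⟨0, Nat.pos_of_ne_zero hn⟩ ⟨0, Nat.pos_of_ne_zero hn⟩
    rw [one_div, Real.log_inv]
    linarith
  rw [orderedLogLik, orderedLogLik, ← sum_sub_distrib]
  refine abs_sum_pair_le _ hpos (fun p => ?_) fun p h1 h2 => ?_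
  · split_ifs
    · simpa using hpos
    · have h1 := hlog ψ p.1 p.2
      have h2 := hlog ψ' p.1 p.2
      rw [one_div, Real.log_inv, abs_le]
      constructor <;> linarith
  · simp [edgeFactor, h1, h2]

theorem orderedLogLik_sub_sub_le {Λ Λ' : Matrix (Fin K) (Fin K) ℝ} {δ t : ℝ} (hδ0 : 0 < δ)
    (hδ : ∀ k l, δ ≤ Λ k l ∧ Λ k l ≤ 1 - δ) (ht : t ≤ δ / 2) (ht0 : 0 ≤ t)
    (hΛ' : ∀ k l, |Λ' k l - Λ k l| ≤ t)
    (G : SimpleGraph (Fin n)) (ψ ψ' : Fin n → Fin K) :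
    |(orderedLogLik Λ' G ψ - orderedLogLik Λ G ψ) - (orderedLogLik Λ' G ψ' - orderedLogLik Λ G ψ')|
      ≤ 4 * t / δ * (2 * n * hammingDist ψ ψ') := by
  have hδ' : ∀ k l, δ / 2 ≤ Λ' k l ∧ Λ' k l ≤ 1 - δ / 2 := by
    intro k l
    have h1 := abs_le.1 (hΛ' k l)
    have h2 := hδ k l
    constructor <;> linarith
  have hlog : ∀ (φ : Fin n → Fin K) u v,
      |Real.log (edgeFactor Λ' φ G u v) - Real.log (edgeFactor Λ φ G u v)| ≤ t / (δ / 2) := by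
    intro φ u v
    refine (abs_log_sub_log_le (m := δ / 2) (by linarith) (edgeFactor_mem hδ' G φ u v).1
      (by linarith [(edgeFactor_mem hδ G φ u v).1])).trans
      (div_le_div_of_nonneg_right ?_ (by linarith))
    have := hΛ' (φ u) (φ v)
    unfold edgeFactor
    split_ifs
    · exact this
    · rw [show (1 - Λ' (φ u) (φ v) - (1 - Λ (φ u) (φ v))) = -(Λ' (φ u) (φ v) - Λ (φ u) (φ v)) by
        ring, abs_neg]
      exact this
  simp only [orderedLogLik, ← sum_sub_distrib]
  refine abs_sum_pair_le _ (by positivity) (fun p => ?_) fun p h1 h2 => ?_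
  · split_ifs
    · simp only [sub_self, abs_zero]
      positivity
    · have h1 := abs_le.1 (hlog ψ p.1 p.2)
      have h2 := abs_le.1 (hlog ψ' p.1 p.2)
      have h3 : 4 * t / δ = t / (δ / 2) + t / (δ / 2) := by field_simp; ring
      rw [h3, abs_le]
      constructor <;> linarith
  · simp [edgeFactor, h1, h2]

theorem blockSize_comp_perm (ψ : Fin n → Fin K) (π : Equiv.Perm (Fin n)) (k : Fin K) :
    blockSize (ψ ∘ π) k = blockSize ψ k := by
  rw [blockSize_eq_sum, blockSize_eq_sum]
  exact Equiv.sum_comp π fun v => if ψ v = k then 1 else 0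

/-- Exchanging the label of a vertex missing from block `k` with that of a vertex wrongly placed
in block `k` reduces the number of differences. -/
theorem hammingDist_swap_lt {b ψ : Fin n → Fin K} {v w : Fin n} {k : Fin K} (hv : ψ v = k)
    (hv' : b v ≠ k) (hw : b w = k) (hw' : ψ w ≠ k) :
    hammingDist b (ψ ∘ Equiv.swap v w) < hammingDist b ψ := by
  refine card_lt_card (ssubset_iff_of_subset (fun x => ?_) |>.2 ⟨w, ?_, ?_⟩)
  · simp only [mem_filter, mem_univ, true_and, Function.comp_apply]
    intro hx
    rcases eq_or_ne x v with rfl | hxv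
    · rwa [hv]
    · rcases eq_or_ne x w with rfl | hxw
      · rwa [hw, ne_comm]
      · rwa [Equiv.swap_apply_of_ne_of_ne hxv hxw] at hx
  · simpa [hw] using hw'.symm
  · simp [hw, hv]

/-- There is an assignment with the block sizes of `c` that differs from `b` on at most as many
vertices as the block sizes differ. -/
theorem exists_close_assignment {b c : Fin n → Fin K} {S : Finset (Fin n)}
    (hc : ∀ i ∈ S, c i = b i) :
    ∃ ψ : Fin n → Fin K, (∀ i ∈ S, ψ i = b i) ∧ (∀ k, blockSize ψ k = blockSize c k) ∧
      (hammingDist b ψ : ℝ) ≤ ∑ k, |(blockSize c k : ℝ) - blockSize b k| := by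
  classical
  obtain ⟨ψ, hψ, hmin⟩ := exists_min_image (univ.filter fun ψ : Fin n → Fin K =>
    (∀ i ∈ S, ψ i = b i) ∧ ∀ k, blockSize ψ k = blockSize c k) (hammingDist b)
    ⟨c, by simpa using hc⟩
  simp only [mem_filter, mem_univ, true_and] at hψ hmin
  refine ⟨ψ, hψ.1, hψ.2, ?_⟩
  have hk : ∀ k, (#{v | ψ v = k ∧ b v ≠ k} : ℝ) ≤ |(blockSize c k : ℝ) - blockSize b k| := by
    intro k
    have hbal : #{v | ψ v = k ∧ b v ≠ k} + blockSize b k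
        = #{v | b v = k ∧ ψ v ≠ k} + blockSize c k := by
      rw [← hψ.2 k, blockSize_eq_sum, blockSize_eq_sum, card_filter, card_filter,
        ← sum_add_distrib, ← sum_add_distrib]
      refine sum_congr rfl fun v _ => ?_
      by_cases h1 : ψ v = k <;> by_cases h2 : b v = k <;> simp [h1, h2]
    have hzero : #{v | ψ v = k ∧ b v ≠ k} = 0 ∨ #{v | b v = k ∧ ψ v ≠ k} = 0 := by
      by_contra! h
      obtain ⟨v, hv⟩ := card_pos.1 (Nat.pos_of_ne_zero h.1)
      obtain ⟨w, hw⟩ := card_pos.1 (Nat.pos_of_ne_zero h.2)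
      simp only [mem_filter, mem_univ, true_and] at hv hw
      refine (hammingDist_swap_lt hv.1 hv.2 hw.1 hw.2).not_ge
        (hmin _ ⟨fun i hi => ?_, fun k => (blockSize_comp_perm ψ _ k).trans (hψ.2 k)⟩)
      have hvS : i ≠ v := by
        rintro rfl
        exact hv.2 ((hψ.1 i hi).symm.trans hv.1)
      have hwS : i ≠ w := by
        rintro rfl
        exact hw.2 ((hψ.1 i hi).trans hw.1)
      rw [Function.comp_apply, Equiv.swap_apply_of_ne_of_ne hvS hwS, hψ.1 i hi]
    rcases hzero with h | h
    · rw [h]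
      simp
    · rw [h, zero_add] at hbal
      rw [← hbal]
      push_cast
      rw [add_sub_cancel_right]
      exact le_abs_self _
  refine le_trans (le_of_eq ?_) (sum_le_sum fun k _ => hk k)
  rw [hammingDist]
  norm_cast
  rw [card_eq_sum_card_fiberwise (f := ψ) (t := univ) fun _ _ => mem_univ _]
  refine sum_congr rfl fun k _ => ?_
  rw [filter_filter]
  congr 1
  ext v
  simp only [mem_filter, mem_univ, true_and]
  grind

end Perturbation

/-- Deterministic core: with a likelihood gap and accurate estimates, the number of vertices
misplaced by the matched assignment is controlled by the error of the estimated block sizes. -/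
theorem hammingDist_matched_le {n K : ℕ} [NeZero K] {Λ Λ' : Matrix (Fin K) (Fin K) ℝ} (hsymm : Λ.IsSymm)
    {δ t : ℝ} (hδ0 : 0 < δ) (hδ : ∀ k l, δ ≤ Λ k l ∧ Λ k l ≤ 1 - δ)
    (hsymm' : ∀ k l, Λ' k l = Λ' l k) (ht : t ≤ δ / 2) (ht0 : 0 ≤ t)
    (hΛ' : ∀ k l, |Λ' k l - Λ k l| ≤ t) {G : SimpleGraph (Fin n)} {b c : Fin n → Fin K}
    {S : Finset (Fin n)} (hc : ∀ i ∈ S, c i = b i) {σ : Equiv.Perm (NonSeed S)}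
    (hσ : IsMatching S G (logOdds Λ' c) σ) {M : ℕ} {r : ℝ} (hr0 : 0 < r)
    (hG : LikelihoodGap Λ b S M r G) (htn : 4 * t * n ≤ δ * (M * Real.log (1 / r))) :
    M * Real.log (1 / r) * hammingDist b (matched S c σ) ≤
      (n * Real.log (1 / δ) + M * Real.log (1 / r)) *
        ∑ k, |(blockSize c k : ℝ) - blockSize b k| := by
  have hΛ : ∀ k l, 0 < Λ k l ∧ Λ k l < 1 := fun k l => by
    have := hδ k l
    constructor <;> linarith
  have hΛ1 : ∀ k l, 0 < Λ' k l ∧ Λ' k l < 1 := fun k l => by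
    have h1 := abs_le.1 (hΛ' k l)
    have h2 := hδ k l
    constructor <;> linarith
  obtain ⟨ψ, hψS, hψsize, hψd⟩ := exists_close_assignment hc
  have hopt := orderedLogLik_le_of_isMatching hsymm' hΛ1 hσ
    (fun i hi => (hψS i hi).trans (hc i hi).symm) hψsize
  set φ := matched S c σ with hφ
  have hφS : ∀ i ∈ S, φ i = b i := fun i hi => (matched_of_mem σ hi).trans (hc i hi)
  have hgap := Real.log_le_log (sbmProb_pos hΛ φ G) (hG φ hφS)
  rw [Real.log_mul (pow_pos hr0 _).ne' (sbmProb_pos hΛ b G).ne', Real.log_pow] at hgap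
  have e1 := orderedLogLik_eq (fun k l => hsymm.apply l k) hΛ G b
  have e2 := orderedLogLik_eq (fun k l => hsymm.apply l k) hΛ G φ
  have h1 := (abs_le.1 (orderedLogLik_sub_le hδ0 hδ G b ψ)).2
  have h2 := (abs_le.1 (orderedLogLik_sub_sub_le hδ0 hδ ht ht0 hΛ' G ψ φ)).1
  have htri : (hammingDist ψ φ : ℝ) ≤ hammingDist b ψ + hammingDist b φ := by
    exact_mod_cast hammingDist_triangle_left ψ φ b
  set D := ∑ k, |(blockSize c k : ℝ) - blockSize b k|
  have hlam : 4 * t / δ * n ≤ M * Real.log (1 / r) := by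
    rw [div_mul_eq_mul_div, div_le_iff₀ hδ0]
    linarith
  have hlog : Real.log r = -Real.log (1 / r) := by rw [one_div, Real.log_inv, neg_neg]
  rw [hlog] at hgap
  push_cast at hgap
  set lam := Real.log (1 / r)
  have ht4 : 0 ≤ 4 * t / δ * n := by positivity
  have h3 : 4 * t / δ * (2 * n * (hammingDist ψ φ : ℝ))
      ≤ 2 * (M * lam * (D + hammingDist b φ)) := by
    calc 4 * t / δ * (2 * n * (hammingDist ψ φ : ℝ))
        = 2 * ((4 * t / δ * n) * hammingDist ψ φ) := by ring
      _ ≤ 2 * ((M * lam) * (D + hammingDist b φ)) := by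
          gcongr
          · exact ht4.trans hlam
          · linarith
      _ = _ := by ring
  have hC : 0 ≤ Real.log (1 / δ) := by
    have := hδ 0 0
    rw [one_div, Real.log_inv, neg_nonneg]
    exact Real.log_nonpos hδ0.le (by linarith)
  have h4 : Real.log (1 / δ) * (2 * n * (hammingDist b ψ : ℝ))
      ≤ Real.log (1 / δ) * (2 * n * D) := by gcongr
  nlinarith

/-! ### Nomination lists -/

section Lists

variable {n K : ℕ} {S : Finset (Fin n)}

theorem exists_nomList_lt {α : Type*} [LinearOrder α] (f : NonSeed S → α) :
    ∃ L : NomList S, ∀ v w, f v < f w → L v < L w := by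
  let e := Fintype.equivFin (NonSeed S)
  refine ⟨e.trans (Tuple.sort (f ∘ e.symm)).symm, fun v w h => ?_⟩
  by_contra! hle
  have := Tuple.monotone_sort (f ∘ e.symm) hle
  simp only [Function.comp_apply, Equiv.trans_apply, Equiv.apply_symm_apply,
    Equiv.symm_apply_apply] at this
  exact this.not_gt h

theorem canonicalScheme_nonempty [NeZero K] (Λ : Matrix (Fin K) (Fin K) ℝ) (b : Fin n → Fin K)
    (G : SimpleGraph (Fin n)) : (canonicalScheme Λ b S G).Nonempty := by
  obtain ⟨L, hL⟩ := exists_nomList_lt fun v : NonSeed S => -posterior Λ b S G v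
  refine ⟨L, ?_⟩
  simp only [canonicalScheme, mem_filter, mem_univ, true_and]
  exact fun v w h => hL v w (neg_lt_neg h)

theorem mlSchemeHat_nonempty [NeZero K] (b : Fin n → Fin K) (c : Finset (Fin n) → Fin n → Fin K)
    (σ : (S : Finset (Fin n)) → SimpleGraph (Fin n) → Equiv.Perm (NonSeed S))
    (G : SimpleGraph (Fin n)) : (mlSchemeHat b c σ S G).Nonempty := by
  classical
  set φ := matched S (c S) (σ S G) with hφ
  set Λ' := LambdaHat b S G
  obtain ⟨L, hL⟩ := exists_nomList_lt fun v : NonSeed S =>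
    if φ v = 0 then toLex ((0 : ℕ), etaScore Λ' S G φ v) else toLex (1, -xiScore Λ' S G φ v)
  refine ⟨L, ?_⟩
  simp only [mlSchemeHat, mem_filter, mem_univ, true_and]
  refine fun v w => ⟨fun hv hw => hL v w ?_, fun hv hw h => hL v w ?_, fun hv hw h => hL v w ?_⟩
  · rw [if_pos hv, if_neg hw, Prod.Lex.toLex_lt_toLex]
    exact Or.inl one_pos
  · rw [if_pos hv, if_pos hw, Prod.Lex.toLex_lt_toLex]
    exact Or.inr ⟨rfl, h⟩
  · rw [if_neg hv, if_neg hw, Prod.Lex.toLex_lt_toLex]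
    exact Or.inr ⟨rfl, neg_lt_neg h⟩

theorem card_rank_le (L : NomList S) {i : ℕ} (hi : i < Fintype.card (NonSeed S)) :
    #{v : NonSeed S | (L v : ℕ) ≤ i} = i + 1 := by
  have h : #{v : NonSeed S | (L v : ℕ) ≤ i} = #(Finset.Iic (⟨i, hi⟩ : Fin _)) := by
    refine card_bij' (fun v _ => L v) (fun x _ => L.symm x) ?_ ?_ (by simp) (by simp)
    · intro v hv
      simpa [Fin.le_def] using hv
    · intro x hx
      simpa [Fin.le_def] using hx
  rw [h, Fin.card_Iic]

theorem numTarget_le [NeZero K] (b : Fin n → Fin K) (S : Finset (Fin n)) :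
    numTarget b S ≤ Fintype.card (NonSeed S) :=
  card_filter_le _ _

theorem AP_nonneg [NeZero K] (b : Fin n → Fin K) (L : NomList S) : 0 ≤ AP b S L := by
  unfold AP
  positivity

theorem AP_le_one [NeZero K] (b : Fin n → Fin K) (L : NomList S) : AP b S L ≤ 1 := by
  unfold AP
  rcases Nat.eq_zero_or_pos (numTarget b S) with h0 | h0
  · simp [h0]
  have hN : (0 : ℝ) < numTarget b S := by exact_mod_cast h0
  rw [one_div, inv_mul_le_iff₀ hN, mul_one]
  refine (sum_le_card_nsmul _ _ 1 fun i hi => ?_).trans (by simp)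
  rw [div_le_one (by positivity)]
  have h := card_rank_le L ((mem_range.1 hi).trans_le (numTarget_le b S))
  have h' : #{v : NonSeed S | (L v : ℕ) ≤ i ∧ b v = 0} ≤ i + 1 := by
    rw [← h]
    exact card_le_card (monotone_filter_right _ fun v _ hv => hv.1)
  exact_mod_cast h'

theorem card_nonseed_ne_le (b φ : Fin n → Fin K) :
    #{v : NonSeed S | b v ≠ φ v} ≤ hammingDist b φ := by
  refine card_le_card_of_injOn (fun v => (v : Fin n)) (fun v hv => ?_) fun v _ w _ h =>
    Subtype.ext h
  simpa using hv

/-- Up to any rank below the number of targets, a list that starts with the nonseeds labelled `0`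
by `φ` has at most as many nontargets as `φ` has errors. -/
theorem rank_le_card_add_hammingDist [NeZero K] {b φ : Fin n → Fin K} {L : NomList S}
    (hL : ∀ v w : NonSeed S, φ v = 0 → φ w ≠ 0 → L v < L w) {i : ℕ} (hi : i < numTarget b S) :
    i + 1 ≤ #{v : NonSeed S | (L v : ℕ) ≤ i ∧ b v = 0} + hammingDist b φ := by
  classical
  have hcard := card_rank_le L (hi.trans_le (numTarget_le b S))
  refine le_trans ?_ (Nat.add_le_add_left (card_nonseed_ne_le (S := S) b φ) _)
  by_cases hw : ∃ w : NonSeed S, (L w : ℕ) ≤ i ∧ φ w ≠ 0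
  · obtain ⟨w, hwi, hw0⟩ := hw
    refine le_trans (show i + 1 ≤ numTarget b S from hi) ((card_le_card fun v hv => ?_).trans
      (card_union_le _ _))
    simp only [mem_filter, mem_univ, true_and, mem_union] at hv ⊢
    by_cases h : φ v = 0
    · have := hL v w h hw0
      exact Or.inl ⟨(Fin.lt_def.1 this).le.trans hwi, hv⟩
    · exact Or.inr fun h' => h (h' ▸ hv)
  · push Not at hw
    rw [← hcard]
    refine (card_le_card fun v hv => ?_).trans (card_union_le _ _)
    simp only [mem_filter, mem_univ, true_and, mem_union] at hv ⊢
    by_cases h : b v = 0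
    · exact Or.inl ⟨hv, h⟩
    · exact Or.inr fun h' => h (h'.trans (hw v hv))

theorem sum_inv_sqrt_le (N : ℕ) : ∑ i ∈ range N, 1 / √((i : ℝ) + 1) ≤ 2 * √N := by
  induction N with
  | zero => simp
  | succ N ih =>
    rw [sum_range_succ]
    have h1 : (0 : ℝ) < √((N : ℝ) + 1) := Real.sqrt_pos.2 (by positivity)
    have h2 := Real.sq_sqrt (by positivity : (0 : ℝ) ≤ (N : ℝ) + 1)
    have h3 := Real.sq_sqrt (Nat.cast_nonneg (α := ℝ) N)
    have h4 : 1 / √((N : ℝ) + 1) ≤ 2 * √((N : ℝ) + 1) - 2 * √N := by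
      rw [div_le_iff₀ h1]
      nlinarith [sq_nonneg (√((N : ℝ) + 1) - √N)]
    push_cast
    linarith

theorem one_sub_le_AP [NeZero K] {b φ : Fin n → Fin K} {L : NomList S}
    (hL : ∀ v w : NonSeed S, φ v = 0 → φ w ≠ 0 → L v < L w) (hN : 0 < numTarget b S) :
    1 - 2 * √((hammingDist b φ : ℝ) / numTarget b S) ≤ AP b S L := by
  set d : ℝ := ((hammingDist b φ : ℕ) : ℝ) with hd
  have hd0 : 0 ≤ d := by positivity
  have hN' : (0 : ℝ) < numTarget b S := by exact_mod_cast hN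
  have hterm : ∀ i ∈ range (numTarget b S), 1 - √d * (1 / √((i : ℝ) + 1)) ≤
      (#{v : NonSeed S | (L v : ℕ) ≤ i ∧ b v = 0} : ℝ) / ((i : ℝ) + 1) := by
    intro i hi
    have h := rank_le_card_add_hammingDist hL (mem_range.1 hi)
    have h' : (i : ℝ) + 1 ≤ #{v : NonSeed S | (L v : ℕ) ≤ i ∧ b v = 0} + d := by
      rw [hd]
      exact_mod_cast h
    have hi0 : (0 : ℝ) < (i : ℝ) + 1 := by positivity
    rw [mul_one_div, ← Real.sqrt_div hd0]
    set x := d / ((i : ℝ) + 1) with hx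
    have hx0 : 0 ≤ x := by positivity
    have hs := Real.sq_sqrt hx0
    have hs0 := Real.sqrt_nonneg x
    set q := (#{v : NonSeed S | (L v : ℕ) ≤ i ∧ b v = 0} : ℝ) / ((i : ℝ) + 1) with hq
    have hq0 : 0 ≤ q := by positivity
    have h1 : 1 ≤ q + x := by
      rw [hq, hx, ← add_div, le_div_iff₀ hi0]
      linarith
    rcases le_total 1 (√x) with h2 | h2
    · linarith
    · nlinarith
  have hsum := sum_le_sum hterm
  rw [sum_sub_distrib, ← mul_sum, sum_const, card_range, nsmul_eq_mul, mul_one] at hsum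
  have h2 := mul_le_mul_of_nonneg_left (sum_inv_sqrt_le (numTarget b S)) (Real.sqrt_nonneg d)
  have h3 : √(d / numTarget b S) * numTarget b S = √d * √(numTarget b S) := by
    rw [Real.sqrt_div hd0]
    have h4 := Real.mul_self_sqrt hN'.le
    have h5 := (Real.sqrt_pos.2 hN').ne'
    field_simp
    rw [← h4]
    ring_nf
    simp
  unfold AP
  rw [one_div, inv_mul_eq_div, le_div_iff₀ hN', sub_mul, mul_assoc, h3]
  linarith

end Lists

/-! ### Random seeds -/

section Seeds

variable {n m : ℕ}

theorem seedProb_mono {p q : Finset (Fin n) → Prop} (h : ∀ S, #S = m → p S → q S) :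
    seedProb n m p ≤ seedProb n m q := by
  classical
  unfold seedProb
  gcongr with S hS
  exact h S (mem_powersetCard.1 hS).2

theorem seedProb_not (hm : m ≤ n) (p : Finset (Fin n) → Prop) :
    seedProb n m (fun S => ¬ p S) = 1 - seedProb n m p := by
  classical
  have h0 : (n.choose m : ℝ) ≠ 0 := by exact_mod_cast (Nat.choose_pos hm).ne'
  have h := card_filter_add_card_filter_not (s := powersetCard m (univ : Finset (Fin n))) p
  rw [card_powersetCard, card_univ, Fintype.card_fin] at h
  rw [eq_sub_iff_add_eq, seedProb, seedProb, ← add_div, div_eq_one_iff_eq h0]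
  rw [add_comm] at h
  norm_cast
  convert h

/-- Markov's inequality. -/
theorem seedProb_le_sum (p : Finset (Fin n) → Prop) (X : Finset (Fin n) → ℝ)
    (hX : ∀ S, 0 ≤ X S) (h : ∀ S, #S = m → p S → 1 ≤ X S) :
    seedProb n m p ≤ (∑ S ∈ powersetCard m (univ : Finset (Fin n)), X S) / n.choose m := by
  classical
  unfold seedProb
  gcongr
  rw [card_filter]
  push_cast
  refine sum_le_sum fun S hS => ?_
  split_ifs with hp
  · exact h S (mem_powersetCard.1 hS).2 hp
  · exact hX S

end Seeds

/-! ### Expected average precision -/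

section EAP

variable {n K : ℕ} [NeZero K] {Λ : Matrix (Fin K) (Fin K) ℝ}
  (hΛ : ∀ k l, 0 < Λ k l ∧ Λ k l < 1)

theorem sum_AP_div_le_one (b : Fin n → Fin K) {S : Finset (Fin n)} (T : Finset (NomList S)) :
    (∑ L ∈ T, AP b S L) / (#T : ℝ) ≤ 1 := by
  refine div_le_one_of_le₀ ?_ (by positivity)
  simpa using sum_le_card_nsmul T (AP b S) 1 fun L _ => AP_le_one b L

include hΛ

theorem EAP_le_one (b : Fin n → Fin K) {m : ℕ} (hm : m ≤ n) (𝓛 : Scheme n) :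
    EAP Λ b m 𝓛 ≤ 1 := by
  classical
  have h0 : (0 : ℝ) < n.choose m := by exact_mod_cast Nat.choose_pos hm
  unfold EAP
  rw [← mul_sum, one_div, inv_mul_le_iff₀ h0, mul_one]
  refine (sum_le_card_nsmul _ _ 1 fun S _ => ?_).trans (by simp)
  rw [← sum_sbmProb Λ b]
  exact sum_le_sum fun G _ =>
    mul_le_of_le_one_right (sbmProb_pos hΛ b G).le (sum_AP_div_le_one b _)

theorem le_EAP (b : Fin n → Fin K) {m : ℕ} {𝓛 : Scheme n}
    (hne : ∀ S G, (𝓛 S G).Nonempty) {ε : ℝ} (hε : ε ≤ 1)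
    (h : 1 - ε ≤ seedProb n m fun S =>
      1 - ε ≤ graphProb Λ b fun G => ∀ L ∈ 𝓛 S G, 1 - ε ≤ AP b S L) :
    (1 - ε) * ((1 - ε) * (1 - ε)) ≤ EAP Λ b m 𝓛 := by
  classical
  have hε' : 0 ≤ 1 - ε := by linarith
  have havg : ∀ S G, 0 ≤ (∑ L ∈ 𝓛 S G, AP b S L) / (#(𝓛 S G) : ℝ) := fun S G =>
    div_nonneg (sum_nonneg fun L _ => AP_nonneg b L) (by positivity)
  have hgraph : ∀ S, 1 - ε ≤ graphProb Λ b (fun G => ∀ L ∈ 𝓛 S G, 1 - ε ≤ AP b S L) →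
      (1 - ε) * (1 - ε) ≤ ∑ G : SimpleGraph (Fin n), sbmProb Λ b G *
        ((∑ L ∈ 𝓛 S G, AP b S L) / (#(𝓛 S G) : ℝ)) := by
    intro S hS
    refine (mul_le_mul_of_nonneg_right hS hε').trans ?_
    rw [graphProb, sum_mul, sum_filter]
    refine sum_le_sum fun G _ => ?_
    have hP := (sbmProb_pos hΛ b G).le
    split_ifs with hG
    · refine mul_le_mul_of_nonneg_left ?_ hP
      rw [le_div_iff₀ (by exact_mod_cast card_pos.2 (hne S G)), mul_comm, ← nsmul_eq_mul]
      exact card_nsmul_le_sum _ _ _ hG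
    · exact mul_nonneg hP (havg S G)
  refine (mul_le_mul_of_nonneg_right h (mul_nonneg hε' hε')).trans ?_
  rw [seedProb, div_mul_eq_mul_div, EAP, ← mul_sum, one_div, inv_mul_eq_div]
  refine div_le_div_of_nonneg_right ?_ (by positivity)
  rw [card_filter]
  push_cast
  rw [sum_mul]
  refine sum_le_sum fun S _ => ?_
  split_ifs with hS
  · rw [one_mul]
    exact hgraph S hS
  · rw [zero_mul]
    exact sum_nonneg fun G _ => mul_nonneg (sbmProb_pos hΛ b G).le (havg S G)

omit hΛ in
theorem tendsto_EAP_one (hΛ : ∀ k l, 0 < Λ k l ∧ Λ k l < 1) {b : (n : ℕ) → Fin n → Fin K}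
    {m : ℕ → ℕ} (hm : ∀ n, m n ≤ n)
    {𝓛 : (n : ℕ) → Scheme n} (hne : ∀ n S G, (𝓛 n S G).Nonempty)
    (h : ∀ ε > 0, ∀ᶠ n in atTop, 1 - ε ≤ seedProb n (m n) fun S =>
      1 - ε ≤ graphProb Λ (b n) fun G => ∀ L ∈ 𝓛 n S G, 1 - ε ≤ AP (b n) S L) :
    Tendsto (fun n => EAP Λ (b n) (m n) (𝓛 n)) atTop (𝓝 1) := by
  rw [Metric.tendsto_nhds]
  intro ε hε
  have hη : 0 < min 1 (ε / 4) := lt_min one_pos (by linarith)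
  filter_upwards [h _ hη] with n hn
  have h1 := le_EAP hΛ (b n) (hne n) (min_le_left _ _) hn
  have h2 := EAP_le_one hΛ (b n) (hm n) (𝓛 n)
  have h3 := min_le_right 1 (ε / 4)
  have h4 := min_le_left 1 (ε / 4)
  rw [Real.dist_eq, abs_lt]
  constructor
  · nlinarith [mul_nonneg hη.le hη.le, mul_nonneg (mul_nonneg hη.le hη.le) (sub_nonneg.2 h4)]
  · linarith

end EAP

/-! ### The number of seeds in a block -/

section Hypergeometric

variable {n m : ℕ}

theorem card_filter_mem_mul (hn : 1 ≤ n) (hm : 1 ≤ m) (v : Fin n) :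
    (#{S ∈ powersetCard m (univ : Finset (Fin n)) | v ∈ S} : ℝ) * n = n.choose m * m := by
  have h := card_filter_powersetCard_subset {v} (univ : Finset (Fin n)) m (subset_univ _)
    (by simpa using hm)
  simp only [singleton_subset_iff, card_univ, Fintype.card_fin, card_singleton] at h
  rw [h]
  obtain ⟨n, rfl⟩ := Nat.exists_eq_add_of_le' hn
  obtain ⟨m, rfl⟩ := Nat.exists_eq_add_of_le' hm
  have := Nat.add_one_mul_choose_eq n m
  simp only [Nat.add_sub_cancel]
  rw [mul_comm]
  exact_mod_cast this

theorem card_filter_mem_mem_mul (hn : 2 ≤ n) (hm : 2 ≤ m) {v w : Fin n} (hvw : v ≠ w) :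
    (#{S ∈ powersetCard m (univ : Finset (Fin n)) | v ∈ S ∧ w ∈ S} : ℝ) * (n * (n - 1))
      = n.choose m * (m * (m - 1)) := by
  have h := card_filter_powersetCard_subset {v, w} (univ : Finset (Fin n)) m (subset_univ _)
    (by rw [card_pair hvw]; exact hm)
  simp only [insert_subset_iff, singleton_subset_iff, card_univ, Fintype.card_fin,
    card_pair hvw] at h
  rw [h]
  obtain ⟨n, rfl⟩ := Nat.exists_eq_add_of_le' hn
  obtain ⟨m, rfl⟩ := Nat.exists_eq_add_of_le' hm
  have h1 : ((n : ℝ) + 1) * n.choose m = (n + 1).choose (m + 1) * (m + 1) := by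
    exact_mod_cast Nat.add_one_mul_choose_eq n m
  have h2 : ((n : ℝ) + 2) * (n + 1).choose (m + 1) = (n + 2).choose (m + 2) * (m + 2) := by
    exact_mod_cast Nat.add_one_mul_choose_eq (n + 1) (m + 1)
  simp only [Nat.add_sub_cancel]
  push_cast
  linear_combination ((n : ℝ) + 2) * h1 + ((m : ℝ) + 1) * h2

/-- Second moment of the (scaled and centred) hypergeometric distribution. -/
theorem sum_sq_card_inter (hn : 2 ≤ n) (hm : 2 ≤ m) (B : Finset (Fin n)) :
    (∑ S ∈ powersetCard m (univ : Finset (Fin n)), ((#{v ∈ B | v ∈ S} : ℝ) * n - m * #B) ^ 2)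
        * (n - 1)
      = n.choose m * (#B * m * (n - #B) * (n - m)) := by
  have hn0 : (n : ℝ) ≠ 0 := by positivity
  have hn1 : (n : ℝ) - 1 ≠ 0 := by
    have : (2 : ℝ) ≤ n := by exact_mod_cast hn
    linarith
  have hS : ∀ S : Finset (Fin n), (#{v ∈ B | v ∈ S} : ℝ) = ∑ v ∈ B, if v ∈ S then 1 else 0 :=
    fun S => (sum_boole _ _).symm
  have h1 : ∑ S ∈ powersetCard m (univ : Finset (Fin n)), (#{v ∈ B | v ∈ S} : ℝ)
      = #B * (n.choose m * m / n) := by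
    simp only [hS]
    rw [sum_comm, ← nsmul_eq_mul]
    refine sum_eq_card_nsmul fun v _ => ?_
    rw [sum_boole, eq_div_iff hn0]
    exact card_filter_mem_mul (by omega) (by omega) v
  have h2 : ∑ S ∈ powersetCard m (univ : Finset (Fin n)), (#{v ∈ B | v ∈ S} : ℝ) ^ 2
      = #B * (n.choose m * m / n) +
        #B * (#B - 1) * (n.choose m * (m * (m - 1)) / (n * (n - 1))) := by
    simp only [hS, sq, sum_mul_sum]
    rw [sum_comm]
    have hv : ∀ v ∈ B, ∑ S ∈ powersetCard m (univ : Finset (Fin n)),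
        ∑ w ∈ B, (if v ∈ S then (1 : ℝ) else 0) * (if w ∈ S then 1 else 0)
        = n.choose m * m / n + (#B - 1) * (n.choose m * (m * (m - 1)) / (n * (n - 1))) := by
      intro v hv
      rw [sum_comm, ← add_sum_erase _ _ hv]
      congr 1
      · rw [eq_div_iff hn0, ← card_filter_mem_mul (by omega) (by omega) v, ← sum_boole]
        congr 1
        exact sum_congr rfl fun S _ => by split_ifs <;> simp
      · rw [← Nat.cast_one, ← Nat.cast_sub (card_pos.2 ⟨v, hv⟩), ← card_erase_of_mem hv,
          ← nsmul_eq_mul]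
        refine sum_eq_card_nsmul fun w hw => ?_
        rw [Nat.cast_one, eq_div_iff (mul_ne_zero hn0 hn1),
          ← card_filter_mem_mem_mul hn hm (ne_of_mem_erase hw).symm, ← sum_boole]
        congr 1
        exact sum_congr rfl fun S _ => by
          by_cases h1 : v ∈ S <;> by_cases h2 : w ∈ S <;> simp [h1, h2]
    rw [sum_congr rfl hv, sum_const, nsmul_eq_mul]
    ring
  have h3 : ∀ x : ℝ, (x * n - m * #B) ^ 2 = n ^ 2 * x ^ 2 - 2 * n * m * #B * x + (m * #B) ^ 2 :=
    fun x => by ring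
  simp only [h3]
  rw [sum_add_distrib, sum_sub_distrib, ← mul_sum, ← mul_sum, h1, h2, sum_const, card_powersetCard,
    card_univ, Fintype.card_fin, nsmul_eq_mul]
  field_simp
  ring

/-- For every block `k` the number of seeds is close to its mean `#S * n_k / n`. Both are multiplied
by `n`, and the tolerance is of the order of `√L` standard deviations. -/
def Balanced {K : ℕ} (b : Fin n → Fin K) (L : ℝ) (S : Finset (Fin n)) : Prop :=
  ∀ k, |(#(seedBlock b S k) : ℝ) * n - #S * blockSize b k| ≤ √(L * (#S * (n - #S) * n))

theorem one_sub_le_seedProb_balanced {K : ℕ} (b : Fin n → Fin K) (hn : 2 ≤ n) (hm : 2 ≤ m)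
    (hmn : m < n) {L : ℝ} (hL : 0 < L) : 1 - K / L ≤ seedProb n m (Balanced b L) := by
  have hN : (0 : ℝ) < n.choose m := by exact_mod_cast Nat.choose_pos hmn.le
  have hn' : (2 : ℝ) ≤ n := by exact_mod_cast hn
  have hm' : (0 : ℝ) < m := by exact_mod_cast (by omega : 0 < m)
  have hu : (0 : ℝ) < n - m := by
    have : (m : ℝ) < n := by exact_mod_cast hmn
    linarith
  have hq : 0 < L * (m * (n - m) * n) := by positivity
  have hB : ∀ S k, (#(seedBlock b S k) : ℝ) = #{v ∈ ({v | b v = k} : Finset (Fin n)) | v ∈ S} := by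
    intro S k
    rw [seedBlock, filter_filter]
    congr 2
    ext v
    simp [and_comm]
  have hnot := seedProb_le_sum (n := n) (m := m) (fun S => ¬ Balanced b L S)
    (fun S => ∑ k, (((#(seedBlock b S k) : ℝ) * n - m * blockSize b k) ^ 2 /
      (L * (m * (n - m) * n)))) (fun S => sum_nonneg fun k _ => by positivity) (by
      intro S hS h
      simp only [Balanced, hS, not_forall, not_le] at h
      obtain ⟨k, hk⟩ := h
      refine le_trans ?_ (single_le_sum (fun k _ => by positivity) (mem_univ k))
      rw [one_le_div hq, ← sq_abs]
      exact (Real.lt_sq_of_sqrt_lt hk).le)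
  rw [seedProb_not hmn.le] at hnot
  have hterm : ∀ k, (∑ S ∈ powersetCard m (univ : Finset (Fin n)),
      (((#(seedBlock b S k) : ℝ) * n - m * blockSize b k) ^ 2 / (L * (m * (n - m) * n))))
      ≤ n.choose m / L := by
    intro k
    have h := sum_sq_card_inter hn hm ({v | b v = k} : Finset (Fin n))
    simp only [← hB] at h
    rw [← blockSize] at h
    have ha : (blockSize b k : ℝ) * (n - blockSize b k) ≤ n * (n - 1) := by
      have h1 : (blockSize b k : ℝ) * (n - blockSize b k) ≤ n ^ 2 / 4 := by
        nlinarith [sq_nonneg ((n : ℝ) - 2 * blockSize b k)]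
      nlinarith
    rw [← sum_div, div_le_div_iff₀ hq hL]
    have hpos : (0 : ℝ) < n - 1 := by linarith
    refine le_of_mul_le_mul_right ?_ hpos
    calc _ = L * ((∑ S ∈ powersetCard m (univ : Finset (Fin n)),
          ((#(seedBlock b S k) : ℝ) * n - m * blockSize b k) ^ 2) * (n - 1)) := by ring
      _ = L * (n.choose m * (m * (n - m))) * (blockSize b k * (n - blockSize b k)) := by
          rw [h]; ring
      _ ≤ L * (n.choose m * (m * (n - m))) * (n * (n - 1)) := by gcongr
      _ = _ := by ring
  have hsum : (∑ S ∈ powersetCard m (univ : Finset (Fin n)), ∑ k,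
      (((#(seedBlock b S k) : ℝ) * n - m * blockSize b k) ^ 2 / (L * (m * (n - m) * n))))
      / n.choose m ≤ K / L := by
    rw [sum_comm, div_le_iff₀ hN]
    refine (sum_le_sum fun k _ => hterm k).trans (le_of_eq ?_)
    rw [sum_const, card_univ, Fintype.card_fin, nsmul_eq_mul]
    ring
  linarith

end Hypergeometric

/-! ### The number of nonseeds tends to infinity -/

theorem numTarget_add_card_seedBlock {n K : ℕ} [NeZero K] (b : Fin n → Fin K)
    (S : Finset (Fin n)) : numTarget b S + #(seedBlock b S 0) = blockSize b 0 := by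
  rw [blockSize_eq_sum, sum_eq_sum_seed_add_sum_nonseed S, numTarget, card_filter, add_comm,
    seedBlock, card_filter]
  congr 1
  exact (sum_coe_sort S fun v => if b v = 0 then 1 else 0).symm

/-- With few nonseeds, all of them lie outside block `0` with probability bounded below. -/
theorem pow_le_seedProb_numTarget_eq_zero {n K m : ℕ} [NeZero K] (b : Fin n → Fin K) (hmn : m ≤ n)
    {a : ℝ} (ha0 : 0 < a) {u : ℕ} (hu : u = n - m) (hn : 0 < n)
    (hb : a * n ≤ n - blockSize b 0) (hua : (u : ℝ) ≤ a / 2 * n) :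
    (a / 2) ^ u ≤ seedProb n m fun S => ¬ 0 < numTarget b S := by
  classical
  have hN : (0 : ℝ) < n.choose m := by exact_mod_cast Nat.choose_pos hmn
  have hn' : (0 : ℝ) < n := by exact_mod_cast hn
  set a0 := blockSize b 0 with ha0_def
  have hle : a0 ≤ n := by
    have : (a0 : ℝ) ≤ n := by nlinarith
    exact_mod_cast this
  have hau : u ≤ n - a0 := by
    have : (u : ℝ) ≤ ((n - a0 : ℕ) : ℝ) := by
      rw [Nat.cast_sub hle]
      nlinarith
    exact_mod_cast this
  have hcount : (n - a0).choose u ≤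
      #{S ∈ powersetCard m (univ : Finset (Fin n)) | ¬ 0 < numTarget b S} := by
    have h := card_filter_powersetCard_subset ({v | b v = 0} : Finset (Fin n)) univ m
      (subset_univ _) (by rw [← blockSize, ← ha0_def]; omega)
    rw [← blockSize, ← ha0_def, card_univ, Fintype.card_fin] at h
    have h2 : m - a0 = n - a0 - u := by omega
    rw [h2, Nat.choose_symm hau] at h
    rw [← h]
    refine card_le_card (monotone_filter_right _ fun S _ hS => ?_)
    have h3 := numTarget_add_card_seedBlock b S
    have h4 : blockSize b 0 ≤ #(seedBlock b S 0) := by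
      refine card_le_card fun v hv => ?_
      rw [seedBlock, mem_filter]
      exact ⟨hS hv, by simpa using hv⟩
    omega
  have hchoose : (n.choose m : ℝ) ≤ n ^ u / u.factorial := by
    rw [← Nat.choose_symm hmn, ← hu]
    exact Nat.choose_le_pow_div u n
  have hlow : ((a / 2 * n) ^ u : ℝ) / u.factorial ≤ (n - a0).choose u := by
    refine le_trans ?_ (Nat.pow_le_choose u (n - a0))
    gcongr
    rw [Nat.cast_sub (by omega)]
    push_cast
    rw [Nat.cast_sub hle]
    linarith
  rw [seedProb, le_div_iff₀ hN]
  calc (a / 2) ^ u * (n.choose m : ℝ) ≤ (a / 2) ^ u * (n ^ u / u.factorial) := by gcongr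
    _ = (a / 2 * n) ^ u / u.factorial := by rw [mul_pow]; ring
    _ ≤ _ := by
      refine hlow.trans (Nat.cast_le.2 ?_)
      convert hcount

theorem eventually_le_card_nonseed {K : ℕ} [NeZero K] {b : (n : ℕ) → Fin n → Fin K} {m : ℕ → ℕ}
    (hm : ∀ n, m n ≤ n) {a : ℝ} (ha0 : 0 < a)
    (hb : ∀ᶠ n : ℕ in atTop, a * n ≤ n - blockSize (b n) 0)
    (htarget : Tendsto (fun n => seedProb n (m n) fun S => 0 < numTarget (b n) S) atTop (𝓝 1))
    (C : ℝ) : ∀ᶠ n : ℕ in atTop, C ≤ n - m n := by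
  obtain ⟨L, hL⟩ := exists_nat_ge C
  have hpos : 0 < (min 1 (a / 2)) ^ L := pow_pos (lt_min one_pos (by linarith)) _
  have h1 : ∀ᶠ n in atTop, 1 - (min 1 (a / 2)) ^ L <
      seedProb n (m n) fun S => 0 < numTarget (b n) S :=
    htarget.eventually (lt_mem_nhds (by linarith))
  have h2 : ∀ᶠ n : ℕ in atTop, (L : ℝ) / (a / 2) ≤ n :=
    tendsto_natCast_atTop_atTop.eventually_ge_atTop _
  filter_upwards [h1, h2, hb, eventually_gt_atTop 0] with n h1 h2 hbn hn
  by_contra! hlt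
  have huL : n - m n ≤ L := by
    have : ((n - m n : ℕ) : ℝ) ≤ L := by
      rw [Nat.cast_sub (hm n)]
      linarith
    exact_mod_cast this
  rw [div_le_iff₀ (by linarith)] at h2
  have h3 := pow_le_seedProb_numTarget_eq_zero (b n) (hm n) ha0 rfl hn hbn
    ((Nat.cast_le (α := ℝ)).2 huL |>.trans (by linarith))
  rw [seedProb_not (hm n)] at h3
  have h4 : (min 1 (a / 2)) ^ L ≤ (a / 2) ^ (n - m n) :=
    (pow_le_pow_of_le_one (le_min zero_le_one (by linarith)) (min_le_left _ _) huL).trans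
      (pow_le_pow_left₀ (le_min zero_le_one (by linarith)) (min_le_right _ _) _)
  linarith

/-! ### Bounds for given seeds -/

section FixedSeeds

variable {n K : ℕ}

theorem exists_uniform_bound [NeZero K] {Λ : Matrix (Fin K) (Fin K) ℝ}
    (hΛ : ∀ k l, 0 < Λ k l ∧ Λ k l < 1) :
    ∃ δ : ℝ, 0 < δ ∧ ∀ k l, δ ≤ Λ k l ∧ Λ k l ≤ 1 - δ := by
  obtain ⟨p, -, hp⟩ := exists_min_image (univ : Finset (Fin K × Fin K))
    (fun p => min (Λ p.1 p.2) (1 - Λ p.1 p.2)) ⟨(0, 0), mem_univ _⟩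
  refine ⟨_, lt_min (hΛ p.1 p.2).1 (sub_pos.2 (hΛ p.1 p.2).2), fun k l => ?_⟩
  have := le_min_iff.1 (hp (k, l) (mem_univ _))
  exact ⟨this.1, le_sub_comm.1 this.2⟩

theorem le_card_seedBlock_of_balanced {b : Fin n → Fin K} {S : Finset (Fin n)} {L a : ℝ}
    (hL : 0 ≤ L) (ha : 0 < a) (hS : #S < n) (hbal : Balanced b L S)
    (hb : ∀ k, a * n ≤ blockSize b k) (hm : 4 * L ≤ a ^ 2 * #S) (k : Fin K) :
    a / 2 * #S ≤ (#(seedBlock b S k) : ℝ) := by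
  have hn : (0 : ℝ) < n := by exact_mod_cast (Nat.zero_le _).trans_lt hS
  have hs : (#S : ℝ) < n := by exact_mod_cast hS
  have hs0 : (0 : ℝ) ≤ #S := by positivity
  have hq : √(L * (#S * (n - #S) * n)) ≤ a / 2 * #S * n := by
    refine Real.sqrt_le_iff.2 ⟨by positivity, ?_⟩
    calc L * (#S * (n - #S) * n) ≤ L * (#S * n * n) := by gcongr; linarith
      _ = (4 * L) * (#S * n ^ 2 / 4) := by ring
      _ ≤ a ^ 2 * #S * (#S * n ^ 2 / 4) := by gcongr
      _ = _ := by ring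
  have h := (abs_le.1 ((hbal k).trans hq)).1
  refine le_of_mul_le_mul_right ?_ hn
  nlinarith [mul_le_mul_of_nonneg_left (hb k) hs0]

theorem le_numTarget_of_balanced [NeZero K] {b : Fin n → Fin K} {S : Finset (Fin n)} {L a : ℝ}
    (hL : 0 ≤ L) (ha : 0 < a) (hS : #S < n) (hbal : Balanced b L S)
    (hb : ∀ k, a * n ≤ blockSize b k) (hu : 4 * L ≤ a ^ 2 * (n - #S)) :
    a / 2 * (n - #S) ≤ (numTarget b S : ℝ) := by
  have hn : (0 : ℝ) < n := by exact_mod_cast (Nat.zero_le _).trans_lt hS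
  have hs : (#S : ℝ) < n := by exact_mod_cast hS
  have hs0 : (0 : ℝ) ≤ #S := by positivity
  have hu0 : (0 : ℝ) < n - #S := by linarith
  have hq : √(L * (#S * (n - #S) * n)) ≤ a / 2 * (n - #S) * n := by
    refine Real.sqrt_le_iff.2 ⟨by positivity, ?_⟩
    calc L * (#S * (n - #S) * n) ≤ L * (n * (n - #S) * n) := by gcongr
      _ = (4 * L) * ((n - #S) * n ^ 2 / 4) := by ring
      _ ≤ a ^ 2 * (n - #S) * ((n - #S) * n ^ 2 / 4) := by gcongr
      _ = _ := by ring
  have h := (abs_le.1 ((hbal 0).trans hq)).2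
  have hN : (numTarget b S : ℝ) + #(seedBlock b S 0) = blockSize b 0 := by
    exact_mod_cast numTarget_add_card_seedBlock b S
  refine le_of_mul_le_mul_right ?_ hn
  nlinarith [mul_le_mul_of_nonneg_left (hb 0) hu0.le]

theorem sum_abs_sizeEstimate_sub_le {b : Fin n → Fin K} {S : Finset (Fin n)} {L : ℝ}
    (hS : 0 < #S) (hbal : Balanced b L S) {nhat : Fin K → ℕ} (h : IsSizeEstimate b S nhat) :
    ∑ k, |(nhat k : ℝ) - blockSize b k| ≤ K * (1 + √(L * (#S * (n - #S) * n)) / #S) := by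
  have hs : (0 : ℝ) < #S := by exact_mod_cast hS
  refine (sum_le_card_nsmul _ _ (1 + √(L * (#S * (n - #S) * n)) / #S) fun k _ => ?_).trans
    (by rw [card_univ, Fintype.card_fin, nsmul_eq_mul])
  have h1 : |(#(seedBlock b S k) : ℝ) * n / #S - blockSize b k|
      ≤ √(L * (#S * (n - #S) * n)) / #S := by
    rw [div_sub' hs.ne', abs_div, abs_of_pos hs]
    exact div_le_div_of_nonneg_right (hbal k) hs.le
  have h2 := abs_add_le ((nhat k : ℝ) - #(seedBlock b S k) * n / #S)
    (#(seedBlock b S k) * n / #S - blockSize b k)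
  rw [sub_add_sub_cancel] at h2
  linarith [(h.2 k).le]

/-- This is where the growth rate `n ^ (2 / 3)` of the number `m` of seeds enters: it makes the
errors of the estimated block sizes, amplified by `n / m`, negligible against the number `u` of
nonseeds. -/
theorem relative_error_le {x m u L η : ℝ} (hm : 0 < m) (hu : 0 < u) (hx : x = m + u) (hL : 0 ≤ L)
    (hη : 0 ≤ η) (h1 : x ^ 2 ≤ η * m ^ 3) (h2 : 1 ≤ η * m) (h3 : 1 ≤ η * u) :
    x / (m * u) * (1 + √(L * (m * u * x)) / m) ≤ 2 * η + √(10 * L * η) := by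
  have hx0 : 0 < x := by linarith
  have hA : x / (m * u) ≤ 2 * η := by
    rw [div_le_iff₀ (by positivity), hx]
    nlinarith [mul_le_mul_of_nonneg_right h2 hu.le, mul_le_mul_of_nonneg_right h3 hm.le]
  have hcube : x ^ 3 ≤ 10 * η * (m ^ 3 * u) := by
    rcases le_total m u with h | h
    · calc x ^ 3 = x * x ^ 2 := by ring
        _ ≤ (2 * u) * (η * m ^ 3) := by gcongr; linarith
        _ ≤ _ := by nlinarith [show 0 ≤ η * m ^ 3 * u by positivity]
    · calc x ^ 3 ≤ (2 * m) ^ 3 := by gcongr; linarith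
        _ = 8 * m ^ 3 * 1 := by ring
        _ ≤ 8 * m ^ 3 * (η * u) := by gcongr
        _ ≤ _ := by nlinarith [show 0 ≤ η * m ^ 3 * u by positivity]
  have hB : x / (m * u) * (√(L * (m * u * x)) / m) ≤ √(10 * L * η) := by
    refine Real.le_sqrt_of_sq_le ?_
    rw [mul_pow, div_pow, div_pow, Real.sq_sqrt (by positivity), div_mul_div_comm,
      div_le_iff₀ (by positivity)]
    calc x ^ 2 * (L * (m * u * x)) = L * (m * u) * x ^ 3 := by ring
      _ ≤ L * (m * u) * (10 * η * (m ^ 3 * u)) := by gcongr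
      _ = _ := by ring
  rw [mul_add, mul_one]
  exact add_le_add hA hB

/-- The likelihood gap and the accuracy of the estimates hold with high probability. -/
theorem one_sub_le_graphProb_gap_and_accurate {Λ : Matrix (Fin K) (Fin K) ℝ}
    (hΛ : ∀ k l, 0 < Λ k l ∧ Λ k l < 1) (hsymm : Λ.IsSymm) {b : Fin n → Fin K}
    {S : Finset (Fin n)} {M : ℕ} (hM : ∀ k, M ≤ #(seedBlock b S k)) (hM2 : 2 ≤ M) {r : ℝ}
    (hr0 : 0 < r) (hr1 : r < 1) (hr : ∀ k l, k ≠ l → affinity (Λ l k) (Λ k k) ≤ r ^ 2)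
    {t ε : ℝ} (ht : 0 < t) (ht1 : t ≤ 1) (h1 : Real.exp (n * K * r ^ M) ≤ 1 + ε)
    (h2 : 2 * K ^ 2 * Real.exp (-((t * M) ^ 2 / 16)) ≤ ε) :
    1 - 2 * ε ≤ graphProb Λ b fun G =>
      LikelihoodGap Λ b S M r G ∧ ∀ k l, |LambdaHat b S G k l - Λ k l| ≤ t := by
  rw [graphProb_eq_one_sub_not]
  have h3 := graphProb_not_likelihoodGap_le hΛ hsymm hM hr0 hr1 hr
  have h4 := graphProb_LambdaHat_tail b S hΛ hsymm hM hM2 ht ht1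
  have h5 := (graphProb_mono hΛ b (E := fun G => ¬ (LikelihoodGap Λ b S M r G ∧
    ∀ k l, |LambdaHat b S G k l - Λ k l| ≤ t)) fun G hG => not_and_or.1 hG).trans
    (graphProb_or_le hΛ b _ _)
  linarith

/-- Misplaced nonseeds are a small fraction of the targets. -/
theorem hammingDist_div_numTarget_le [NeZero K] {Λ : Matrix (Fin K) (Fin K) ℝ} (hsymm : Λ.IsSymm)
    {δ : ℝ} (hδ0 : 0 < δ) (hδ : ∀ k l, δ ≤ Λ k l ∧ Λ k l ≤ 1 - δ) {r : ℝ} (hr0 : 0 < r)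
    (hr1 : r < 1) {b : Fin n → Fin K} {S : Finset (Fin n)} {L a η : ℝ} (hL : 0 ≤ L) (ha : 0 < a)
    (hS0 : 0 < #S) (hS : #S < n) (hbal : Balanced b L S) (hb : ∀ k, a * n ≤ blockSize b k)
    (hu : 4 * L ≤ a ^ 2 * (n - #S)) (hη : 0 ≤ η) (hη1 : (n : ℝ) ^ 2 ≤ η * #S ^ 3)
    (hη2 : 1 ≤ η * #S) (hη3 : 1 ≤ η * (n - #S)) {M : ℕ} (hM : a / 4 * #S ≤ M) (hMn : M ≤ n)
    {nhat : Fin K → ℕ} (hnhat : IsSizeEstimate b S nhat) {c : Fin n → Fin K}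
    (hc : IsLabelling b S nhat c) {G : SimpleGraph (Fin n)} {σ : Equiv.Perm (NonSeed S)}
    (hσ : IsMatching S G (logOdds (LambdaHat b S G) c) σ) (hG : LikelihoodGap Λ b S M r G)
    {t : ℝ} (ht0 : 0 ≤ t) (ht : t ≤ δ / 2) (htn : 4 * t * n ≤ δ * (M * Real.log (1 / r)))
    (hΛ' : ∀ k l, |LambdaHat b S G k l - Λ k l| ≤ t) :
    (hammingDist b (matched S c σ) : ℝ) / numTarget b S ≤
      8 * K * (Real.log (1 / δ) + Real.log (1 / r)) / (a ^ 2 * Real.log (1 / r)) *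
        (2 * η + √(10 * L * η)) := by
  have hs : (0 : ℝ) < #S := by exact_mod_cast hS0
  have hsn : (#S : ℝ) < n := by exact_mod_cast hS
  have hu0 : (0 : ℝ) < n - #S := by linarith
  have hn : (0 : ℝ) < n := by linarith
  have hlam : 0 < Real.log (1 / r) := Real.log_pos (by rw [lt_div_iff₀ hr0]; linarith)
  have hC : 0 ≤ Real.log (1 / δ) := by
    have := hδ 0 0
    rw [one_div, Real.log_inv, neg_nonneg]
    exact Real.log_nonpos hδ0.le (by linarith)
  have hN := le_numTarget_of_balanced hL ha hS hbal hb hu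
  have hN0 : (0 : ℝ) < numTarget b S := lt_of_lt_of_le (by positivity) hN
  have hcore := hammingDist_matched_le hsymm hδ0 hδ (LambdaHat_symm b S G) ht ht0 hΛ' hc.1 hσ hr0
    hG htn
  have hD := sum_abs_sizeEstimate_sub_le hS0 hbal hnhat
  have hsize : ∑ k, |(blockSize c k : ℝ) - blockSize b k| = ∑ k, |(nhat k : ℝ) - blockSize b k| :=
    sum_congr rfl fun k _ => by rw [hc.2 k]
  rw [hsize] at hcore
  have hrel := relative_error_le hs hu0 (by ring : (n : ℝ) = #S + (n - #S)) hL hη hη1 hη2 hη3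
  set lam := Real.log (1 / r)
  set C := Real.log (1 / δ)
  set q := √(L * (#S * (n - #S) * n))
  set d : ℝ := ((hammingDist b (matched S c σ) : ℕ) : ℝ)
  have hd0 : 0 ≤ d := Nat.cast_nonneg _
  have hMn' : (M : ℝ) ≤ n := by exact_mod_cast hMn
  have h1 : a / 4 * #S * lam * d ≤ n * (C + lam) * (K * (1 + q / #S)) := by
    calc a / 4 * #S * lam * d ≤ M * lam * d := by gcongr
      _ ≤ _ := hcore
      _ ≤ (n * C + M * lam) * (K * (1 + q / #S)) := by gcongr
      _ ≤ (n * C + n * lam) * (K * (1 + q / #S)) := by gcongr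
      _ = _ := by ring
  have h2 : d ≤ 4 * n * (C + lam) * (K * (1 + q / #S)) / (a * #S * lam) := by
    rw [le_div_iff₀ (by positivity)]
    linarith
  calc d / numTarget b S ≤ (4 * n * (C + lam) * (K * (1 + q / #S)) / (a * #S * lam)) /
        (a / 2 * (n - #S)) := by gcongr
    _ = 8 * K * (C + lam) / (a ^ 2 * lam) * (n / (#S * (n - #S)) * (1 + q / #S)) := by
        field_simp
        ring
    _ ≤ _ := by gcongr

end FixedSeeds

/-! ### Asymptotics -/

section Asymptotics

variable {K : ℕ} [NeZero K] {b : (n : ℕ) → Fin n → Fin K} {m : ℕ → ℕ}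

theorem eventually_mul_rpow_mul_log_le
    (hseed : ∀ C : ℝ, Tendsto (fun n => seedProb n (m n) fun S =>
      ∀ k, C * ((n : ℝ) ^ (2 / 3 : ℝ) * Real.log n) ≤ (#(seedBlock (b n) S k) : ℝ)) atTop (𝓝 1))
    (C : ℝ) : ∀ᶠ n : ℕ in atTop, C * ((n : ℝ) ^ (2 / 3 : ℝ) * Real.log n) ≤ m n := by
  classical
  filter_upwards [(hseed C).eventually (lt_mem_nhds one_pos)] with n hn
  have hne : (#{S ∈ powersetCard (m n) (univ : Finset (Fin n)) |
      ∀ k, C * ((n : ℝ) ^ (2 / 3 : ℝ) * Real.log n) ≤ (#(seedBlock (b n) S k) : ℝ)}) ≠ 0 := by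
    intro h0
    refine hn.ne' ?_
    rw [seedProb, div_eq_zero_iff]
    left
    norm_cast
  obtain ⟨S, hS⟩ := card_pos.1 (Nat.pos_of_ne_zero hne)
  rw [mem_filter, mem_powersetCard] at hS
  refine (hS.2 0).trans ?_
  rw [← hS.1.2]
  exact_mod_cast card_filter_le _ _

theorem eventually_mul_log_le
    (h : ∀ C : ℝ, ∀ᶠ n : ℕ in atTop, C * ((n : ℝ) ^ (2 / 3 : ℝ) * Real.log n) ≤ m n)
    {C : ℝ} (hC : 0 ≤ C) : ∀ᶠ n : ℕ in atTop, C * Real.log n ≤ m n := by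
  filter_upwards [h C, eventually_ge_atTop 1] with n hn hn1
  have hn1' : (1 : ℝ) ≤ n := by exact_mod_cast hn1
  refine le_trans (mul_le_mul_of_nonneg_left ?_ hC) hn
  exact le_mul_of_one_le_left (Real.log_nonneg hn1') (Real.one_le_rpow hn1' (by norm_num))

theorem eventually_mul_sq_le_cube
    (h : ∀ C : ℝ, ∀ᶠ n : ℕ in atTop, C * ((n : ℝ) ^ (2 / 3 : ℝ) * Real.log n) ≤ m n)
    (C : ℝ) : ∀ᶠ n : ℕ in atTop, C * (n : ℝ) ^ 2 ≤ (m n : ℝ) ^ 3 := by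
  filter_upwards [h (max C 1), eventually_ge_atTop 3] with n hn hn3
  have hC1 : 1 ≤ max C 1 := le_max_right _ _
  have hn3' : (3 : ℝ) ≤ n := by exact_mod_cast hn3
  have hlog : 1 ≤ Real.log n := by
    rw [Real.le_log_iff_exp_le (by linarith)]
    linarith [Real.exp_one_lt_d9]
  have hp : 0 ≤ (n : ℝ) ^ (2 / 3 : ℝ) := by positivity
  have h1 : max C 1 * (n : ℝ) ^ (2 / 3 : ℝ) ≤ m n := by
    refine le_trans (mul_le_mul_of_nonneg_left ?_ (by linarith)) hn
    exact le_mul_of_one_le_right hp hlog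
  have h2 := pow_le_pow_left₀ (by positivity) h1 3
  rw [mul_pow, ← Real.rpow_natCast ((n : ℝ) ^ (2 / 3 : ℝ)), ← Real.rpow_mul (by positivity)] at h2
  norm_num at h2
  refine le_trans ?_ h2
  gcongr
  refine (le_max_left C 1).trans ?_
  exact le_self_pow₀ hC1 (by norm_num)

theorem eventually_mul_le_sq (hm : ∀ n, m n ≤ n)
    (h : ∀ C : ℝ, ∀ᶠ n : ℕ in atTop, C * (n : ℝ) ^ 2 ≤ (m n : ℝ) ^ 3)
    (C : ℝ) : ∀ᶠ n : ℕ in atTop, C * (n : ℝ) ≤ (m n : ℝ) ^ 2 := by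
  filter_upwards [h C, eventually_gt_atTop 0] with n hn hn0
  have hmn : (m n : ℝ) ≤ n := by exact_mod_cast hm n
  have hn0' : (0 : ℝ) < n := by exact_mod_cast hn0
  refine le_of_mul_le_mul_right ?_ hn0'
  nlinarith [mul_le_mul_of_nonneg_left hmn (sq_nonneg (m n : ℝ))]

theorem eventually_le_seeds (hm : ∀ n, m n ≤ n)
    (h : ∀ C : ℝ, ∀ᶠ n : ℕ in atTop, C * (n : ℝ) ^ 2 ≤ (m n : ℝ) ^ 3)
    (C : ℝ) : ∀ᶠ n : ℕ in atTop, C ≤ (m n : ℝ) := by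
  filter_upwards [eventually_mul_le_sq hm h C, eventually_gt_atTop 0] with n hn hn0
  have hmn : (m n : ℝ) ≤ n := by exact_mod_cast hm n
  have hn0' : (0 : ℝ) < n := by exact_mod_cast hn0
  refine le_of_mul_le_mul_right ?_ hn0'
  nlinarith [mul_le_mul_of_nonneg_left hmn (Nat.cast_nonneg (α := ℝ) (m n))]

theorem exists_pos_mul_le (L C : ℝ) {ε : ℝ} (hε : 0 < ε) :
    ∃ η > 0, 2 * √(C * (2 * η + √(10 * L * η))) ≤ ε := by
  have hcont : Continuous fun η : ℝ => 2 * √(C * (2 * η + √(10 * L * η))) := by fun_prop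
  have h0 := hcont.tendsto 0
  simp only [mul_zero, Real.sqrt_zero, add_zero] at h0
  have h1 := (h0.eventually (gt_mem_nhds hε)).filter_mono (nhdsWithin_le_nhds (s := Set.Ioi 0))
  obtain ⟨η, h2, h3⟩ := (h1.and self_mem_nhdsWithin).exists
  exact ⟨η, h3, h2.le⟩

theorem exists_mul_exp_neg_sq_le (C : ℝ) {ε : ℝ} (hε : 0 < ε) :
    ∃ Y > 0, ∀ y ≥ Y, C * Real.exp (-(y ^ 2 / 16)) ≤ ε := by
  have h : Tendsto (fun y : ℝ => C * Real.exp (-(y ^ 2 / 16))) atTop (𝓝 (C * 0)) := by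
    refine (Real.tendsto_exp_neg_atTop_nhds_zero.comp ?_).const_mul C
    exact (tendsto_pow_atTop two_ne_zero).atTop_div_const (by norm_num)
  rw [mul_zero] at h
  obtain ⟨Y, hY⟩ := eventually_atTop.1 (h.eventually (gt_mem_nhds hε))
  exact ⟨max Y 1, lt_max_of_lt_right one_pos, fun y hy => (hY y ((le_max_left _ _).trans hy)).le⟩

end Asymptotics

/-! ### High-probability bounds and the limit -/

/-- Under explicit lower bounds on the numbers of vertices and of seeds, balanced seeds yield with
high probability a graph for which the matched assignment misplaces a small fraction of the targets
and the posterior probabilities separate the targets from the other nonseeds. -/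
theorem one_sub_le_graphProb_of_balanced {n K : ℕ} [NeZero K]
    {Λ : Matrix (Fin K) (Fin K) ℝ} (hsymm : Λ.IsSymm) (hΛ : ∀ k l, 0 < Λ k l ∧ Λ k l < 1)
    {δ : ℝ} (hδ0 : 0 < δ) (hδ : ∀ k l, δ ≤ Λ k l ∧ Λ k l ≤ 1 - δ) {r : ℝ} (hr0 : 0 < r)
    (hr1 : r < 1) (hr : ∀ k l, k ≠ l → affinity (Λ l k) (Λ k k) ≤ r ^ 2) {b : Fin n → Fin K}
    {S : Finset (Fin n)} {L a η ε Y l : ℝ} (hL : 0 ≤ L) (ha : 0 < a) (hS0 : 0 < #S) (hS : #S < n)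
    (hbal : Balanced b L S) (hb : ∀ k, a * n ≤ blockSize b k) (hm : 4 * L ≤ a ^ 2 * #S)
    (hu : 4 * L ≤ a ^ 2 * (n - #S)) (hma : 8 ≤ a * #S) (hη : 0 ≤ η)
    (hη1 : (n : ℝ) ^ 2 ≤ η * #S ^ 3) (hη2 : 1 ≤ η * #S) (hη3 : 1 ≤ η * (n - #S)) (hε : 0 < ε)
    (hε1 : ε < 1) (hl0 : 0 < l) (hl1 : l ≤ 1) (hl : l ≤ Real.log (1 / r))
    (hY : ∀ y ≥ Y, 2 * (K : ℝ) ^ 2 * Real.exp (-(y ^ 2 / 16)) ≤ ε)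
    (hmlog : 8 / (a * Real.log (1 / r)) * Real.log n ≤ #S) (hnK : K / Real.log (1 + ε) ≤ n)
    (hmsq : 64 * Y / (δ * l * a ^ 2) * n ≤ (#S : ℝ) ^ 2)
    {nhat : Fin K → ℕ} (hnhat : IsSizeEstimate b S nhat) {c : Fin n → Fin K}
    (hc : IsLabelling b S nhat c) {σ : SimpleGraph (Fin n) → Equiv.Perm (NonSeed S)}
    (hσ : ∀ G, IsMatching S G (logOdds (LambdaHat b S G) c) (σ G)) :
    1 - 2 * ε ≤ graphProb Λ b fun G =>
      (hammingDist b (matched S c (σ G)) : ℝ) / numTarget b S ≤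
        8 * K * (Real.log (1 / δ) + Real.log (1 / r)) / (a ^ 2 * Real.log (1 / r)) *
          (2 * η + √(10 * L * η)) ∧
      ∀ v w, b v = 0 → b w ≠ 0 → posterior Λ b S G w < posterior Λ b S G v := by
  have hn0 : (0 : ℝ) < n := by exact_mod_cast (Nat.zero_le _).trans_lt hS
  have hlam : 0 < Real.log (1 / r) := hl0.trans_le hl
  have hseeds := le_card_seedBlock_of_balanced hL ha hS hbal hb hm
  -- At least `M` seeds are available in each block.
  obtain ⟨M, hMle, hMge⟩ : ∃ M : ℕ, (∀ k, M ≤ #(seedBlock b S k)) ∧ a / 4 * (#S : ℝ) ≤ M := by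
    refine ⟨⌊a / 2 * (#S : ℝ)⌋₊, fun k => Nat.floor_le_of_le (hseeds k), ?_⟩
    have := (Nat.lt_floor_add_one (a / 2 * (#S : ℝ))).le
    linarith
  have hM2 : 2 ≤ M := by
    have : (2 : ℝ) ≤ M := by linarith
    exact_mod_cast this
  have hMn : M ≤ n := (hMle 0).trans ((card_filter_le _ _).trans hS.le)
  have hMn' : (M : ℝ) ≤ n := by exact_mod_cast hMn
  have hM0 : (0 : ℝ) < M := by positivity
  -- The accuracy of the estimate of `Λ` that the comparison of likelihoods requires.
  obtain ⟨t, ht_def⟩ : ∃ t, t = δ * l * M / (4 * n) := ⟨_, rfl⟩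
  have ht0 : 0 < t := by rw [ht_def]; positivity
  have htδ : t ≤ δ / 2 := by
    rw [ht_def, div_le_iff₀ (by positivity)]
    have h1 : l * M ≤ 1 * n := by gcongr
    nlinarith
  have hδ1 : δ ≤ 1 / 2 := by
    have := hδ 0 0
    linarith
  have htn : 4 * t * n ≤ δ * (M * Real.log (1 / r)) := by
    have h1 : 4 * t * n = δ * (M * l) := by
      rw [ht_def]
      field_simp
    rw [h1]
    gcongr
  have hrM : r ^ M ≤ 1 / (n : ℝ) ^ 2 := by
    have h1 : 2 * Real.log n ≤ M * Real.log (1 / r) := by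
      rw [div_mul_eq_mul_div, div_le_iff₀ (by positivity)] at hmlog
      nlinarith
    rw [← Real.log_le_log_iff (by positivity) (by positivity), Real.log_pow, one_div, Real.log_inv,
      Real.log_pow]
    rw [one_div, Real.log_inv] at h1
    push_cast
    linarith
  have hexp : Real.exp (n * K * r ^ M) ≤ 1 + ε := by
    rw [← Real.le_log_iff_exp_le (by linarith)]
    calc n * K * r ^ M ≤ n * K * (1 / (n : ℝ) ^ 2) := by gcongr
      _ = K / n := by field_simp
      _ ≤ _ := by
        rw [div_le_iff₀ hn0]
        rwa [div_le_iff₀' (Real.log_pos (by linarith))] at hnK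
  have htM : Y ≤ t * M := by
    rw [div_mul_eq_mul_div, div_le_iff₀ (by positivity)] at hmsq
    rw [ht_def, div_mul_eq_mul_div, le_div_iff₀ (by positivity)]
    have h1 : (a / 4 * (#S : ℝ)) ^ 2 ≤ (M : ℝ) ^ 2 := by gcongr
    have h2 := mul_le_mul_of_nonneg_left h1 (by positivity : 0 ≤ δ * l)
    nlinarith
  refine (one_sub_le_graphProb_gap_and_accurate hΛ hsymm hMle hM2 hr0 hr1 hr ht0 (by linarith)
    hexp (hY _ htM)).trans (graphProb_mono hΛ b fun G hG => ⟨?_, fun v w hv hw => ?_⟩)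
  · exact hammingDist_div_numTarget_le hsymm hδ0 hδ hr0 hr1 hL ha hS0 hS hbal hb hu hη hη1 hη2 hη3
      hMge hMn hnhat hc (hσ G) hG.1 ht0.le htδ htn hG.2
  · exact posterior_lt_of_likelihoodGap hΛ hr0 hr1 hG.1 (by linarith) hv hw

/-- With high probability over the seeds, with high probability over the graph: the matched
assignment misplaces a small fraction of the targets, and the posterior probabilities separate the
targets from the other nonseeds. -/
theorem eventually_one_sub_le_seedProb {K : ℕ} [NeZero K] [Nontrivial (Fin K)]
    {Λ : Matrix (Fin K) (Fin K) ℝ} (hsymm : Λ.IsSymm) (hΛ : ∀ k l, 0 < Λ k l ∧ Λ k l < 1)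
    (hdiag : ∀ k l, k ≠ l → Λ k k ≠ Λ k l) {b : (n : ℕ) → Fin n → Fin K} {a : ℝ} (ha : 0 < a)
    (hb : ∀ᶠ n : ℕ in atTop, ∀ k, a * n ≤ blockSize (b n) k)
    {m : ℕ → ℕ} (hm : ∀ n, m n ≤ n)
    (hseed : ∀ C : ℝ, ∀ᶠ n : ℕ in atTop, C * ((n : ℝ) ^ (2 / 3 : ℝ) * Real.log n) ≤ m n)
    (htarget : Tendsto (fun n => seedProb n (m n) fun S => 0 < numTarget (b n) S) atTop (𝓝 1))
    {nhat : (n : ℕ) → Finset (Fin n) → Fin K → ℕ}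
    (hnhat : ∀ n S, #S = m n → S.Nonempty → IsSizeEstimate (b n) S (nhat n S))
    {c : (n : ℕ) → Finset (Fin n) → Fin n → Fin K}
    (hc : ∀ n S, #S = m n → S.Nonempty → IsLabelling (b n) S (nhat n S) (c n S))
    {σ : (n : ℕ) → (S : Finset (Fin n)) → SimpleGraph (Fin n) → Equiv.Perm (NonSeed S)}
    (hσ : ∀ n S G, #S = m n → S.Nonempty →
      IsMatching S G (logOdds (LambdaHat (b n) S G) (c n S)) (σ n S G))
    {ε : ℝ} (hε : 0 < ε) :
    ∀ᶠ n : ℕ in atTop, 1 - ε ≤ seedProb n (m n) fun S => 0 < numTarget (b n) S ∧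
      1 - ε ≤ graphProb Λ (b n) fun G =>
        2 * √((hammingDist (b n) (matched S (c n S) (σ n S G)) : ℝ) / numTarget (b n) S) ≤ ε ∧
        ∀ v w, b n v = 0 → b n w ≠ 0 → posterior Λ (b n) S G w < posterior Λ (b n) S G v := by
  obtain ⟨δ, hδ0, hδ⟩ := exists_uniform_bound hΛ
  obtain ⟨r, hr0, hr1, hr⟩ := exists_affinity_le hΛ hsymm hdiag
  have hlam : 0 < Real.log (1 / r) := Real.log_pos (by rw [lt_div_iff₀ hr0]; linarith)
  set lam := Real.log (1 / r)
  have hK : (0 : ℝ) < K := by exact_mod_cast Nat.pos_of_ne_zero (NeZero.ne K)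
  -- A deviation of more than `√L` standard deviations of a seed count has probability
  -- at most `K / L`, which is `ε` for this choice of `L`.
  set L : ℝ := K / ε with hL_def
  have hL : 0 < L := div_pos hK hε
  obtain ⟨η, hη0, hη⟩ := exists_pos_mul_le L
    (8 * K * (Real.log (1 / δ) + lam) / (a ^ 2 * lam)) hε
  set ε' := min (ε / 2) (1 / 2)
  have hε' : 0 < ε' := lt_min (by linarith) (by norm_num)
  have hε'1 : ε' < 1 := (min_le_right _ _).trans_lt (by norm_num)
  obtain ⟨Y, hY0, hY⟩ := exists_mul_exp_neg_sq_le (2 * K ^ 2) hε'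
  set l := min lam 1
  have hl0 : 0 < l := lt_min hlam one_pos
  have hcube := eventually_mul_sq_le_cube hseed
  have hbnot : ∀ᶠ n : ℕ in atTop, a * n ≤ n - blockSize (b n) 0 := by
    obtain ⟨k, hk⟩ := exists_ne (0 : Fin K)
    filter_upwards [hb] with n hn
    have hdisj : blockSize (b n) k + blockSize (b n) 0 ≤ n := by
      rw [blockSize, blockSize, ← card_union_of_disjoint]
      · exact (card_le_univ _).trans (Fintype.card_fin n).le
      · rw [disjoint_left]
        intro v hv hv'
        simp only [mem_filter, mem_univ, true_and] at hv hv'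
        exact hk (hv.symm.trans hv')
    have hdisj' : (blockSize (b n) k : ℝ) + blockSize (b n) 0 ≤ n := by exact_mod_cast hdisj
    linarith [hn k]
  have hu := eventually_le_card_nonseed hm ha hbnot htarget
  have hlogn : ∀ᶠ n : ℕ in atTop, (K : ℝ) / Real.log (1 + ε') ≤ n :=
    tendsto_natCast_atTop_atTop.eventually_ge_atTop _
  filter_upwards [hb, eventually_ge_atTop 2, eventually_le_seeds hm hcube (4 * L / a ^ 2),
    hu (4 * L / a ^ 2), eventually_le_seeds hm hcube (8 / a), eventually_le_seeds hm hcube 2,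
    hu 1, hcube (1 / η), eventually_le_seeds hm hcube (1 / η), hu (1 / η),
    eventually_mul_log_le hseed (C := 8 / (a * lam)) (by positivity), hlogn,
    eventually_mul_le_sq hm hcube (64 * Y / (δ * l * a ^ 2))]
    with n hb hn2 hmL huL hma hm2 hu1 hη1 hη2 hη3 hmlog hnK hmsq
  have hn0 : (0 : ℝ) < n := by exact_mod_cast (by omega : 0 < n)
  have hm0 : (0 : ℝ) < m n := by linarith
  have hm2' : 2 ≤ m n := by exact_mod_cast hm2
  have hmn' : (m n : ℝ) < n := by linarith
  have hmn : m n < n := by exact_mod_cast hmn'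
  have ha2 : 0 < a ^ 2 := by positivity
  rw [div_le_iff₀' ha2] at hmL huL
  rw [div_le_iff₀' hη0] at hη2 hη3
  rw [one_div_mul_eq_div, div_le_iff₀' hη0] at hη1
  rw [div_le_iff₀' ha] at hma
  have hbal := one_sub_le_seedProb_balanced (b n) hn2 hm2' hmn hL
  have hKL : (K : ℝ) / L = ε := by rw [hL_def]; field_simp
  rw [hKL] at hbal
  refine hbal.trans (seedProb_mono fun S hS hSbal => ?_)
  have hSne : S.Nonempty := card_pos.1 (by omega)
  rw [← hS] at hm0 hm2 hmn' hmn hmL huL hu1 hη1 hη2 hη3 hma hmlog hmsq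
  have hN := le_numTarget_of_balanced hL.le ha hmn hSbal hb huL
  have hN0 : 0 < numTarget (b n) S := by
    have : (0 : ℝ) < numTarget (b n) S := lt_of_lt_of_le (by positivity) hN
    exact_mod_cast this
  refine ⟨hN0, ?_⟩
  have hε2 : 1 - ε ≤ 1 - 2 * ε' := by
    have := min_le_left (ε / 2) (1 / 2)
    linarith
  refine hε2.trans ((one_sub_le_graphProb_of_balanced hsymm hΛ hδ0 hδ hr0 hr1 hr hL.le ha
    (by omega) hmn hSbal hb hmL huL hma hη0.le hη1 hη2 hη3 hε' hε'1 hl0 (min_le_right _ _)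
    (min_le_left _ _) hY hmlog hnK hmsq (hnhat n S hS hSne) (hc n S hS hSne)
    fun G => hσ n S G hS hSne).trans (graphProb_mono hΛ (b n) fun G hG => ⟨?_, hG.2⟩))
  exact le_trans (mul_le_mul_of_nonneg_left (Real.sqrt_le_sqrt hG.1) zero_le_two) hη

end

end VertexNomination

theorem theorem3 {K : ℕ} [NeZero K] (Λ : Matrix (Fin K) (Fin K) ℝ)
    (hsymm : Λ.IsSymm)
    (hΛ : ∀ k l, 0 < Λ k l ∧ Λ k l < 1)
    (hdiag : ∀ k l, k ≠ l → Λ k k ≠ Λ k l)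
    (b : (n : ℕ) → Fin n → Fin K)
    (hb : ∀ k, (fun n => (VertexNomination.blockSize (b n) k : ℝ)) =Θ[atTop] fun n => (n : ℝ))
    (m : ℕ → ℕ) (hm : ∀ n, m n ≤ n)
    -- with probability tending to one, every `m_k` exceeds any multiple of `n ^ (2/3) * log n`
    (hseed : ∀ C : ℝ, Tendsto (fun n => VertexNomination.seedProb n (m n) fun S =>
        ∀ k, C * ((n : ℝ) ^ (2 / 3 : ℝ) * Real.log n)
          ≤ (#(VertexNomination.seedBlock (b n) S k) : ℝ)) atTop (𝓝 1))
    -- with probability tending to one, average precision is defined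
    (htarget : Tendsto (fun n => VertexNomination.seedProb n (m n) fun S =>
        0 < VertexNomination.numTarget (b n) S) atTop (𝓝 1))
    -- estimated block sizes
    (nhat : (n : ℕ) → Finset (Fin n) → Fin K → ℕ)
    (hnhat : ∀ n S, #S = m n → S.Nonempty → VertexNomination.IsSizeEstimate (b n) S (nhat n S))
    -- labelling of the vertices of the estimated log-odds matrix
    (c : (n : ℕ) → Finset (Fin n) → Fin n → Fin K)
    (hc : ∀ n S, #S = m n → S.Nonempty →
      VertexNomination.IsLabelling (b n) S (nhat n S) (c n S))
    -- the chosen solution of the graph matching problem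
    (σ : (n : ℕ) → (S : Finset (Fin n)) → SimpleGraph (Fin n) →
      Equiv.Perm (VertexNomination.NonSeed S))
    (hσ : ∀ n S G, #S = m n → S.Nonempty →
      VertexNomination.IsMatching S G
        (VertexNomination.logOdds (VertexNomination.LambdaHat (b n) S G) (c n S)) (σ n S G)) :
    Tendsto (fun n => VertexNomination.EAP Λ (b n) (m n)
        (VertexNomination.mlSchemeHat (b n) (c n) (σ n))) atTop (𝓝 1) ∧
      VertexNomination.IsConsistent Λ b m
        (fun n => VertexNomination.mlSchemeHat (b n) (c n) (σ n)) := by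
  open VertexNomination in
  have hevent : ∀ ε > 0, ∀ᶠ n : ℕ in atTop, 1 - ε ≤ seedProb n (m n) fun S =>
      0 < numTarget (b n) S ∧ 1 - ε ≤ graphProb Λ (b n) fun G =>
        2 * √((hammingDist (b n) (matched S (c n S) (σ n S G)) : ℝ) / numTarget (b n) S) ≤ ε ∧
        ∀ v w, b n v = 0 → b n w ≠ 0 →
          posterior Λ (b n) S G w < posterior Λ (b n) S G v := by
    intro ε hε
    rcases subsingleton_or_nontrivial (Fin K) with hK | hK
    · -- With a single block every list is perfect as soon as there is a target.
      filter_upwards [htarget.eventually (lt_mem_nhds (by linarith : 1 - ε < 1))] with n hn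
      refine hn.le.trans (seedProb_mono fun S _ hS => ⟨hS, ?_⟩)
      have h1 : ∀ G : SimpleGraph (Fin n),
          2 * √((hammingDist (b n) (matched S (c n S) (σ n S G)) : ℝ) / numTarget (b n) S) ≤ ε ∧
          ∀ v w, b n v = 0 → b n w ≠ 0 →
            posterior Λ (b n) S G w < posterior Λ (b n) S G v := by
        intro G
        refine ⟨?_, fun v w _ hw => absurd (Subsingleton.elim _ _) hw⟩
        rw [Subsingleton.elim (matched S (c n S) (σ n S G)) (b n), hammingDist_self]
        simpa using hε.le
      rw [graphProb_eq_one _ _ h1]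
      linarith
    · have hbk : ∀ k, ∃ a : ℝ, 0 < a ∧ ∀ᶠ n : ℕ in atTop, a * n ≤ blockSize (b n) k := by
        intro k
        obtain ⟨C, hC, h⟩ := (hb k).2.exists_pos
        refine ⟨C⁻¹, inv_pos.2 hC, h.bound.mono fun n hn => ?_⟩
        rw [inv_mul_le_iff₀ hC]
        simpa using hn
      choose a ha hab using hbk
      obtain ⟨k0, -, hk0⟩ := exists_min_image univ a univ_nonempty
      refine eventually_one_sub_le_seedProb hsymm hΛ hdiag (ha k0) (b := b) ?_ hm
        (eventually_mul_rpow_mul_log_le hseed) htarget hnhat hc hσ hε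
      filter_upwards [eventually_all.2 hab] with n hn k
      exact (mul_le_mul_of_nonneg_right (hk0 k (mem_univ k)) (Nat.cast_nonneg n)).trans (hn k)
  have hML : Tendsto (fun n => EAP Λ (b n) (m n) (mlSchemeHat (b n) (c n) (σ n))) atTop (𝓝 1) := by
    refine tendsto_EAP_one hΛ hm (fun n S G => mlSchemeHat_nonempty _ _ _ G) fun ε hε => ?_
    filter_upwards [hevent ε hε] with n hn
    refine hn.trans (seedProb_mono fun S _ hS => hS.2.trans (graphProb_mono hΛ (b n)
      fun G hG L hL => ?_))
    simp only [mlSchemeHat, mem_filter, mem_univ, true_and] at hL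
    exact (sub_le_sub_left hG.1 1).trans (one_sub_le_AP (fun v w => (hL v w).1) hS.1)
  have hC : Tendsto (fun n => EAP Λ (b n) (m n) (canonicalScheme Λ (b n))) atTop (𝓝 1) := by
    refine tendsto_EAP_one hΛ hm (fun n S G => canonicalScheme_nonempty _ _ G) fun ε hε => ?_
    filter_upwards [hevent ε hε] with n hn
    refine hn.trans (seedProb_mono fun S _ hS => hS.2.trans (graphProb_mono hΛ (b n)
      fun G hG L hL => ?_))
    simp only [canonicalScheme, mem_filter, mem_univ, true_and] at hL
    have h := one_sub_le_AP (b := b n) (φ := b n) (L := L)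
      (fun v w hv hw => hL v w (hG.2 v w hv hw)) hS.1
    rw [hammingDist_self, Nat.cast_zero, zero_div, Real.sqrt_zero, mul_zero] at h
    linarith
  refine ⟨hML, ?_⟩
  have := (hC.sub hML).abs
  simpa [IsConsistent] using this
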